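/- Let $\pi:X\to C$ be an elliptic surface over $\mathbb C$: $X$ is a smooth compact (algebraic) surface, $C$ a smooth compact curve, the general fiber of $\pi$ is a smooth curve of genus one, and $\pi$ has a section $S_0$, which is the identity of a group law on the smooth part of every fiber. Let $F$ be a fiber of type $I_m$, $m\ge 1$, with components $C_j$ ($j\in\mathbb Z/m$) and nodes $p_j=C_j\cap C_{j+1}$, where $S_0$ meets $C_0$. (For $m=2$, $p_0$ and $p_1$ are the two points of $C_0\cap C_1$; for $m=1$, $C_0$ is a nodal rational curve with node $p_0$, one works with coordinates and rational functions on its normalization $\mathbb P^1$, and the two branches at the node play the roles of $C_j$ and $C_{j+1}$.) A *standard set of affine coordinates* on $F$ consists of an affine coordinate $u_j$ on each $C_j$ such that: (a) $u_j=0$ at $p_{j-1}$ and $u_j=\infty$ at $p_j$; (b) the map $\mathbb C^*\times\mathbb Z/m\to F^{sm}$ sending $(t,j)$ to the point $u_j=t$ of $C_j$ is an isomorphism of groups; (c) with $v_j=1/u_j$, the functions $v_j$ and $u_{j+1}$ extend to local coordinates $V_j$, $U_{j+1}$ on $X$ near $p_j$ such that $V_j=0$ defines $C_{j+1}$ and $U_{j+1}=0$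 defines $C_j$, and $\pi=U_{j+1}V_j$ near $p_j$. Here $\pi$ also denotes the fibration map expressed in a local coordinate of $C$ that vanishes at the image of $F$ and is normalized so that (c) holds. Fix such a coordinate of $C$ and such a set $\{u_j\}$. For a nonzero rational function $g(u)$ let $n_0(g)$ and $n_\infty(g)$ be its orders at $u=0$ and $u=\infty$, and let $c_0(g)$ and $c_\infty(g)$ be the lowest coefficients of its Laurent expansions in $u$ at $u=0$ and in $1/u$ at $u=\infty$. The function group $\mathcal K$ of $F$ is the group of $m$-tuples $(g_0(u_0),\dots,g_{m-1}(u_{m-1}))$ of nonzero rational functions such that $n_\infty(g_j)+n_0(g_{j+1})=0$ and $c_\infty(g_j)=c_0(g_{j+1})$ for all $j\in\mathbb Z/m$, and $\sum_j n_0(g_j)=0$. Lemma 6.3 (restriction lands in $\mathcal K$). Let $G$ be a nonzero rational function on $X$ such that no horizontal component of $\operatorname{div}(G)$ passes through a node of $F$, and let $r_j$ be the order of $G$ along $C_j$. Then each $G/\pi^{r_j}$ restricts to a nonzero rational function $g_j(u_j)$ on $C_j$, and the $m$-tuple $(g_0,\dots,g_{m-1})$ lies in $\mathcal K$. -/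

import Mathlib

open AlgebraicGeometry CategoryTheory Limits
open scoped PowerSeries Polynomial LaurentSeries MonObj

noncomputable section

namespace EllipticFiber

/-! ### The function group of a cycle of `m` projective lines -/

/-- The substitution `g(u) ↦ g(1/v)`, from rational functions of `u` to rational functions of
`v = 1/u`. -/
def swapCoord : RatFunc ℂ →+* RatFunc ℂ :=
  RatFunc.liftRingHom (Polynomial.eval₂RingHom RatFunc.C (RatFunc.X⁻¹ : RatFunc ℂ)) <| by
    apply nonZeroDivisors_le_comap_nonZeroDivisors_of_injective
    rw [injective_iff_map_eq_zero]
    intro p hp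
    let _ : Invertible (RatFunc.X⁻¹ : RatFunc ℂ) :=
      invertibleOfNonzero (inv_ne_zero RatFunc.X_ne_zero)
    have h := (Polynomial.eval₂_reverse_eq_zero_iff (RatFunc.C : ℂ →+* RatFunc ℂ)
      (RatFunc.X⁻¹) p).mpr hp
    rw [invOf_eq_inv, inv_inv] at h
    have h' : algebraMap ℂ[X] (RatFunc ℂ) p.reverse = 0 := by
      rw [← RatFunc.aeval_X_left_eq_algebraMap, Polynomial.aeval_def, RatFunc.algebraMap_eq_C]
      exact h
    rwa [map_eq_zero_iff _ (RatFunc.algebraMap_injective ℂ), Polynomial.reverse_eq_zero] at h'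

/-- `n_0(g)`: the order of the rational function `g` at `u = 0`. -/
def orderZero (g : RatFunc ℂ) : ℤ := (g : ℂ⸨X⸩).order

/-- `c_0(g)`: the lowest coefficient of the Laurent expansion of `g` in powers of `u`. -/
def coeffZero (g : RatFunc ℂ) : ℂ := (g : ℂ⸨X⸩).leadingCoeff

/-- `n_∞(g)`: the order of `g` at `u = ∞`, i.e. the order of `g(1/v)` at `v = 0`. -/
def orderInfty (g : RatFunc ℂ) : ℤ := orderZero (swapCoord g)

/-- `c_∞(g)`: the lowest coefficient of the Laurent expansion of `g` in powers of `v = 1/u`. -/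
def coeffInfty (g : RatFunc ℂ) : ℂ := coeffZero (swapCoord g)

theorem orderZero_mul {f g : RatFunc ℂ} (hf : f ≠ 0) (hg : g ≠ 0) :
    orderZero (f * g) = orderZero f + orderZero g := by
  unfold orderZero
  rw [map_mul, HahnSeries.order_mul] <;> simpa

theorem coeffZero_mul (f g : RatFunc ℂ) : coeffZero (f * g) = coeffZero f * coeffZero g := by
  unfold coeffZero
  rw [map_mul, HahnSeries.leadingCoeff_mul]

theorem orderZero_one : orderZero 1 = 0 := by simp [orderZero]

theorem coeffZero_one : coeffZero 1 = 1 := by simp [coeffZero]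

theorem orderInfty_mul {f g : RatFunc ℂ} (hf : f ≠ 0) (hg : g ≠ 0) :
    orderInfty (f * g) = orderInfty f + orderInfty g := by
  unfold orderInfty
  rw [map_mul, orderZero_mul] <;> simpa

theorem coeffInfty_mul (f g : RatFunc ℂ) : coeffInfty (f * g) = coeffInfty f * coeffInfty g := by
  unfold coeffInfty
  rw [map_mul, coeffZero_mul]

/-- The function group `K` of a fibre of type `I_m`: the `m`-tuples `(g_0, …, g_{m-1})` of nonzero
rational functions, indexed cyclically, with
(a) `n_∞(g_j) + n_0(g_{j+1}) = 0`, (b) `c_∞(g_j) = c_0(g_{j+1})`, (c) `∑ n_0(g_j) = 0`. -/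
def functionGroup (m : ℕ) [NeZero m] : Subgroup (ZMod m → (RatFunc ℂ)ˣ) where
  carrier := {g |
    (∀ j, orderInfty (g j : RatFunc ℂ) + orderZero (g (j + 1) : RatFunc ℂ) = 0) ∧
    (∀ j, coeffInfty (g j : RatFunc ℂ) = coeffZero (g (j + 1) : RatFunc ℂ)) ∧
    ∑ j, orderZero (g j : RatFunc ℂ) = 0}
  one_mem' := by
    refine ⟨fun j => ?_, fun j => ?_, ?_⟩ <;>
      simp [orderInfty, coeffInfty, orderZero_one, coeffZero_one]
  mul_mem' := by
    rintro f g ⟨f1, f2, f3⟩ ⟨g1, g2, g3⟩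
    refine ⟨fun j => ?_, fun j => ?_, ?_⟩
    · have h1 := f1 j
      have h2 := g1 j
      simp only [Pi.mul_apply, Units.val_mul, orderInfty_mul (f j).ne_zero (g j).ne_zero,
        orderZero_mul (f (j + 1)).ne_zero (g (j + 1)).ne_zero]
      linarith
    · simp only [Pi.mul_apply, Units.val_mul, coeffInfty_mul, coeffZero_mul, f2 j, g2 j]
    · simp only [Pi.mul_apply, Units.val_mul]
      rw [Finset.sum_congr rfl fun j _ => orderZero_mul (f j).ne_zero (g j).ne_zero,
        Finset.sum_add_distrib, f3, g3, add_zero]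
  inv_mem' := by
    rintro f ⟨f1, f2, f3⟩
    have hz : ∀ u : (RatFunc ℂ)ˣ, orderZero ((u⁻¹ : (RatFunc ℂ)ˣ) : RatFunc ℂ)
        = -orderZero (u : RatFunc ℂ) := fun u => by
      have h := orderZero_mul u.ne_zero (u⁻¹).ne_zero
      rw [Units.mul_inv, orderZero_one] at h
      linarith
    have hi : ∀ u : (RatFunc ℂ)ˣ, orderInfty ((u⁻¹ : (RatFunc ℂ)ˣ) : RatFunc ℂ)
        = -orderInfty (u : RatFunc ℂ) := fun u => by
      have h := orderInfty_mul u.ne_zero (u⁻¹).ne_zero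
      rw [Units.mul_inv, orderInfty, map_one, orderZero_one] at h
      linarith
    have cz : ∀ u : (RatFunc ℂ)ˣ, coeffZero ((u⁻¹ : (RatFunc ℂ)ˣ) : RatFunc ℂ)
        = (coeffZero (u : RatFunc ℂ))⁻¹ := fun u => by
      have h := coeffZero_mul (u : RatFunc ℂ) ((u⁻¹ : (RatFunc ℂ)ˣ) : RatFunc ℂ)
      rw [Units.mul_inv, coeffZero_one] at h
      exact eq_inv_of_mul_eq_one_right h.symm
    have ci : ∀ u : (RatFunc ℂ)ˣ, coeffInfty ((u⁻¹ : (RatFunc ℂ)ˣ) : RatFunc ℂ)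
        = (coeffInfty (u : RatFunc ℂ))⁻¹ := fun u => by
      have h := coeffInfty_mul (u : RatFunc ℂ) ((u⁻¹ : (RatFunc ℂ)ˣ) : RatFunc ℂ)
      rw [Units.mul_inv, coeffInfty, map_one, coeffZero_one] at h
      exact eq_inv_of_mul_eq_one_right h.symm
    refine ⟨fun j => ?_, fun j => ?_, ?_⟩
    · have h1 := f1 j
      simp only [Pi.inv_apply, hz, hi]
      linarith
    · simp only [Pi.inv_apply, cz, ci, f2 j]
    · simp only [Pi.inv_apply, hz, Finset.sum_neg_distrib, f3, neg_zero]

/-! ### Elliptic surfaces -/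

/-- A fibration `π : X ⟶ C` of a smooth compact complex algebraic surface `X` over a smooth compact
curve `C` (both connected). -/
structure FiberedSurface where
  /-- the surface -/
  X : Scheme.{0}
  /-- the base curve -/
  C : Scheme.{0}
  /-- the fibration -/
  π : X ⟶ C
  /-- the structure morphism of the base curve -/
  str : C ⟶ Spec (.of ℂ)
  integral_X : IsIntegral X
  integral_C : IsIntegral C
  proper_X : IsProper (π ≫ str)
  proper_C : IsProper str
  smooth_X : SmoothOfRelativeDimension 2 (π ≫ str)
  smooth_C : SmoothOfRelativeDimension 1 str

attribute [instance] FiberedSurface.integral_X FiberedSurface.integral_C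
  FiberedSurface.proper_X FiberedSurface.proper_C FiberedSurface.smooth_X FiberedSurface.smooth_C

namespace FiberedSurface

variable (S : FiberedSurface)

instance : IsLocallyNoetherian S.X := LocallyOfFiniteType.isLocallyNoetherian (S.π ≫ S.str)

instance : IsLocallyNoetherian S.C := LocallyOfFiniteType.isLocallyNoetherian S.str

instance : LocallyOfFinitePresentation S.π :=
  have := locallyOfFiniteType_of_comp S.π S.str
  LocallyOfFinitePresentation.iff_locallyOfFiniteType.mpr this

/-- The open subscheme `X^sm` of `X` of the points where `π` is smooth, as a scheme over `C`; its
fibres are the smooth parts `F^sm` of the fibres `F` of `π`. -/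
def smoothPart : Over S.C := Over.mk (S.π.smoothLocus.ι ≫ S.π)

end FiberedSurface

/-- A smooth elliptic surface with a zero section. The group law in the fibres with the zero section
as identity is the group scheme structure of `X^sm` over `C` whose unit is the zero section (the
unit determines it); the general fibre is a smooth connected curve, and then, being proper and
carrying an algebraic group law, it is an elliptic curve. -/
structure EllipticSurface extends FiberedSurface where
  general_fiber : ∃ U : C.Opens, (U : Set C).Nonempty ∧ Smooth (π ∣_ U) ∧
    GeometricallyConnected (π ∣_ U)
  groupLaw : GrpObj toFiberedSurface.smoothPart

attribute [instance] EllipticSurface.groupLaw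

namespace EllipticSurface

variable (S : EllipticSurface)

/-- The zero section `S_0`. -/
def zeroSection : S.C ⟶ S.X := η[S.smoothPart].left ≫ S.π.smoothLocus.ι

theorem zeroSection_comp : S.zeroSection ≫ S.π = 𝟙 S.C := by
  have h := Over.w η[S.smoothPart]
  simpa [zeroSection, FiberedSurface.smoothPart] using h

/-- The point of the curve `C` underlying a `ℂ`-valued point. -/
def basePoint (c : Spec (.of ℂ) ⟶ S.C) : S.C := c (IsLocalRing.closedPoint ℂ)

/-- A local coordinate of the base curve `C` at the point `c`: a regular function on a neighbourhood
of `c` which generates the maximal ideal of the local ring at `c`. -/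
structure LocalCoordinate (c : Spec (.of ℂ) ⟶ S.C) where
  /-- the neighbourhood -/
  U : S.C.Opens
  mem : S.basePoint c ∈ U
  /-- the function -/
  fn : Γ(S.C, U)
  span_eq : IsLocalRing.maximalIdeal (S.C.presheaf.stalk (S.basePoint c)) =
    Ideal.span {S.C.presheaf.germ U (S.basePoint c) mem fn}

variable {S}

namespace LocalCoordinate

variable {c : Spec (.of ℂ) ⟶ S.C} (t : S.LocalCoordinate c)

theorem genericPoint_mem : genericPoint S.X ∈ S.π ⁻¹ᵁ t.U := by
  refine ((genericPoint_spec S.X).mem_open_set_iff (S.π ⁻¹ᵁ t.U).isOpen).mpr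
    ⟨S.zeroSection (S.basePoint c), trivial, ?_⟩
  have h : S.π (S.zeroSection (S.basePoint c)) = S.basePoint c := by
    rw [← Scheme.Hom.comp_apply, S.zeroSection_comp]
    rfl
  change S.π (S.zeroSection (S.basePoint c)) ∈ t.U
  rw [h]
  exact t.mem

/-- The pull-back of the local coordinate to `X`, as a rational function on `X`. This is the
fibration map written `π` (with `π = 0` along `F`) in the ratios `G / π ^ r`. -/
def onSurface : S.X.functionField :=
  S.X.presheaf.germ (S.π ⁻¹ᵁ t.U) (genericPoint S.X) t.genericPoint_mem (S.π.app t.U t.fn)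

end LocalCoordinate

/-! ### Formal coordinates of the surface at a point -/

variable (S) in
/-- A system of formal coordinates `(U, V)` on the surface `X` at a point, given by the Taylor
expansion `𝒪_{X,p} → ℂ⟦U⟧⟦V⟧`, written as a morphism `θ` from the spectrum of `ℂ⟦U⟧⟦V⟧` over `ℂ`:
the closed point goes to `p`, and `θ` identifies `ℂ⟦U⟧⟦V⟧` with the completion of `𝒪_{X,p}`.
(Holomorphic or étale local coordinates at `p` give such a `θ` by Taylor expansion.) -/
structure IsFormalChart (θ : Spec (.of ℂ⟦X⟧⟦X⟧) ⟶ S.X) : Prop where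
  over_base : θ ≫ S.π ≫ S.str =
    Spec.map (CommRingCat.ofHom ((PowerSeries.C (R := ℂ⟦X⟧)).comp (PowerSeries.C (R := ℂ))))
  comap_pow : ∀ n : ℕ,
    (IsLocalRing.maximalIdeal ℂ⟦X⟧⟦X⟧ ^ n).comap (Scheme.stalkClosedPointTo θ).hom =
      IsLocalRing.maximalIdeal
        (S.X.presheaf.stalk (θ (IsLocalRing.closedPoint ℂ⟦X⟧⟦X⟧))) ^ n
  dense : ∀ (n : ℕ) (f : ℂ⟦X⟧⟦X⟧), ∃ a,
    f - (Scheme.stalkClosedPointTo θ).hom a ∈ IsLocalRing.maximalIdeal ℂ⟦X⟧⟦X⟧ ^ n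

/-- In the formal coordinates `(U, V)` given by `θ`, the fibration is `π = U V`, where `π` is
expressed by means of the local coordinate `t` of the base curve. -/
def IsProductOfCoordinates {c : Spec (.of ℂ) ⟶ S.C} (t : S.LocalCoordinate c)
    (θ : Spec (.of ℂ⟦X⟧⟦X⟧) ⟶ S.X) : Prop :=
  ∃ h : θ (IsLocalRing.closedPoint ℂ⟦X⟧⟦X⟧) ∈ S.π ⁻¹ᵁ t.U,
    (Scheme.stalkClosedPointTo θ).hom
      (S.X.presheaf.germ (S.π ⁻¹ᵁ t.U) _ h (S.π.app t.U t.fn)) =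
        PowerSeries.C (PowerSeries.X : ℂ⟦X⟧) * PowerSeries.X

/-! ### Fibres of type `I_m` -/

/-- The inclusion of the punctured affine line with coordinate `T` into the affine line with
coordinate `u = T`. -/
def puncture : Spec (.of (LaurentPolynomial ℂ)) ⟶ Spec (.of ℂ[X]) :=
  Spec.map (CommRingCat.ofHom (Polynomial.toLaurent (R := ℂ)))

/-- The map from the punctured affine line with coordinate `T` to the affine line with
coordinate `v = 1/T`. -/
def punctureInv : Spec (.of (LaurentPolynomial ℂ)) ⟶ Spec (.of ℂ[X]) :=
  Spec.map (CommRingCat.ofHom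
    (Polynomial.eval₂RingHom (LaurentPolynomial.C (R := ℂ)) (LaurentPolynomial.T (-1))))

/-- The `ℂ`-valued point of the affine line with coordinate `a`. -/
def affinePoint (a : ℂ) : Spec (.of ℂ) ⟶ Spec (.of ℂ[X]) :=
  Spec.map (CommRingCat.ofHom (Polynomial.evalRingHom a))

variable (S) in
/-- A fibre `F` of type `I_m` of the elliptic surface, over the point `c` of the base, with affine
coordinates `u_j` on its components `C_j` (`j` in `ℤ/m`) which are `0` at the node
`C_{j-1} ∩ C_j` and `∞` at the node `C_j ∩ C_{j+1}`.
The coordinate `u_j` is given by the inverse parametrization of `C_j` by the projective line (the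
normalization of the nodal curve `C_0` if `m = 1`): `chart j` is this parametrization on the affine
line with coordinate `u_j`, and `chartInfty j` on the affine line with coordinate `v_j = 1/u_j`.
`F` is the scheme-theoretic fibre `pullback π c`. -/
structure FiberOfTypeI (c : Spec (.of ℂ) ⟶ S.C) (m : ℕ) where
  chart : ZMod m → (Spec (.of ℂ[X]) ⟶ pullback S.π c)
  chartInfty : ZMod m → (Spec (.of ℂ[X]) ⟶ pullback S.π c)
  chart_over : ∀ j, chart j ≫ pullback.snd S.π c =
    Spec.map (CommRingCat.ofHom (Polynomial.C (R := ℂ)))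
  chartInfty_over : ∀ j, chartInfty j ≫ pullback.snd S.π c =
    Spec.map (CommRingCat.ofHom (Polynomial.C (R := ℂ)))
  /-- the two parametrizations agree where `v_j = 1/u_j` -/
  glue : ∀ j, puncture ≫ chart j = punctureInv ≫ chartInfty j
  /-- `u_j` is a coordinate of `C_j` away from the nodes; `F` is reduced and smooth there -/
  isOpenImmersion : ∀ j, IsOpenImmersion (puncture ≫ chart j)
  disjoint : ∀ i j, i ≠ j →
    Disjoint (Set.range (puncture ≫ chart i)) (Set.range (puncture ≫ chart j))
  /-- the point `u_j = ∞` of `C_j` is the point `u_{j+1} = 0` of `C_{j+1}` -/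
  node_eq : ∀ j, affinePoint 0 ≫ chartInfty j = affinePoint 0 ≫ chart (j + 1)
  /-- there are `m` distinct nodes -/
  node_injective : Function.Injective fun j =>
    (affinePoint 0 ≫ chartInfty j) (IsLocalRing.closedPoint ℂ)
  node_notMem : ∀ i j,
    (affinePoint 0 ≫ chartInfty j) (IsLocalRing.closedPoint ℂ) ∉ Set.range (puncture ≫ chart i)
  cover : ∀ x : ↥(pullback S.π c), (∃ j, x ∈ Set.range (puncture ≫ chart j)) ∨
    ∃ j, x = (affinePoint 0 ≫ chartInfty j) (IsLocalRing.closedPoint ℂ)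
  /-- the nodes are ordinary double points `U V = 0` of `F` -/
  ordinary : ∀ j, ∃ (t : S.LocalCoordinate c) (θ : Spec (.of ℂ⟦X⟧⟦X⟧) ⟶ S.X),
    S.IsFormalChart θ ∧ IsProductOfCoordinates t θ ∧
    θ (IsLocalRing.closedPoint ℂ⟦X⟧⟦X⟧) =
      (affinePoint 0 ≫ chartInfty j ≫ pullback.fst S.π c) (IsLocalRing.closedPoint ℂ)

namespace FiberOfTypeI

variable {c : Spec (.of ℂ) ⟶ S.C} {m : ℕ} (F : S.FiberOfTypeI c m)

/-- The node `C_j ∩ C_{j+1}` (where `u_j = ∞` and `u_{j+1} = 0`), as a point of `X`. -/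
def node (j : ZMod m) : S.X :=
  (affinePoint 0 ≫ F.chartInfty j ≫ pullback.fst S.π c) (IsLocalRing.closedPoint ℂ)

/-- The parametrization of `C_j` by the coordinate `u_j`, restricted to the generic point of the
affine line. -/
def genericChart (j : ZMod m) : Spec (.of (RatFunc ℂ)) ⟶ S.X :=
  Spec.map (CommRingCat.ofHom (algebraMap ℂ[X] (RatFunc ℂ))) ≫ F.chart j ≫ pullback.fst S.π c

/-- The generic point of the component `C_j`. -/
def component (j : ZMod m) : S.X := F.genericChart j (IsLocalRing.closedPoint (RatFunc ℂ))

/-- The rational function `f` on `X` is regular at the generic point of `C_j`, and its restriction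
to `C_j`, written as a rational function of the coordinate `u_j`, is `g`. -/
def RestrictsTo (j : ZMod m) (f : S.X.functionField) (g : RatFunc ℂ) : Prop :=
  ∃ s : S.X.presheaf.stalk (F.component j),
    algebraMap (S.X.presheaf.stalk (F.component j)) S.X.functionField s = f ∧
    (Scheme.stalkClosedPointTo (F.genericChart j)).hom s = g

/-- The coordinates `u_j` form a standard set of affine coordinates on `F`, adapted to the local
coordinate `t` of the base curve (their zeros and poles are prescribed in `FiberOfTypeI`). -/
structure IsStandard (t : S.LocalCoordinate c) : Prop where
  /-- The map sending `(a, j)` to the point `u_j = a` of `C_j` is an isomorphism of groups from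
  `ℂ* × ℤ/m` to the group `F^sm` of the points of `X^sm` over `c`. -/
  group_iso : ∃ α : ℂˣ × Multiplicative (ZMod m) ≃* (Over.mk c ⟶ S.smoothPart),
    ∀ (a : ℂˣ) (j : ZMod m), (α (a, Multiplicative.ofAdd j)).left ≫ S.π.smoothLocus.ι =
      affinePoint a ≫ F.chart j ≫ pullback.fst S.π c
  /-- Near the node `C_j ∩ C_{j+1}`, the coordinates `u_{j+1}` of `C_{j+1}` and `v_j = 1/u_j` of
  `C_j` extend to coordinates `U`, `V` of `X` such that `V = 0` defines `C_{j+1}`, `U = 0` defines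
  `C_j`, and `π = U V`. -/
  extend_coords : ∀ j, ∃ θ : Spec (.of ℂ⟦X⟧⟦X⟧) ⟶ S.X,
    S.IsFormalChart θ ∧ IsProductOfCoordinates t θ ∧
    Spec.map (CommRingCat.ofHom (PowerSeries.constantCoeff (R := ℂ⟦X⟧))) ≫ θ =
      Spec.map (CommRingCat.ofHom (Polynomial.coeToPowerSeries.ringHom (R := ℂ))) ≫
        F.chart (j + 1) ≫ pullback.fst S.π c ∧
    Spec.map (CommRingCat.ofHom (PowerSeries.map (PowerSeries.constantCoeff (R := ℂ)))) ≫ θ =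
      Spec.map (CommRingCat.ofHom (Polynomial.coeToPowerSeries.ringHom (R := ℂ))) ≫
        F.chartInfty j ≫ pullback.fst S.π c

/-- No horizontal prime divisor of `X` (one that dominates `C`, given by its generic point `x`)
along which `G` has a zero or a pole passes through a node of `F`. -/
def IsRegularAtNodes (G : S.X.functionField) : Prop :=
  ∀ x : S.X, Order.coheight x = 1 → S.π x = genericPoint S.C → Scheme.ord G x ≠ 0 →
    ∀ j, ¬ x ⤳ F.node j

end FiberOfTypeI

end EllipticSurface

end EllipticFiber

end

/-! Everything is decided at one node p of F. Put O = 𝒪_{X,p} and let R = ℂ⟦U⟧⟦V⟧ be its formal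
completion, so that π = UV in R, with C_j the branch U = 0 (coordinate V = 1/u_j) and C_{j+1} the
branch V = 0 (coordinate U = u_{j+1}). Since R is factorial, so is O
(`IsFormalCompletion.uniqueFactorizationMonoid`). Write G as a reduced fraction over O. A prime
factor of its numerator or denominator that does not divide π would be a horizontal zero or pole of
G through p, which is excluded. Hence some a = G π^N lies in O and divides a power of π
(`exists_algebraMap_eq_and_dvd_pow`). In R this gives a = w U^α V^β with w a unit.

Along the branch U = 0, π is a uniformizer of the local ring of X at the generic point of C_j
(`IsFormalBranch.maximalIdeal_eq`). So r_j = α - N, and G/π^{r_j} restricts to w(0,V) V^(β-α).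
Symmetrically r_{j+1} = β - N, and the restriction to C_{j+1} is w(U,0) U^(α-β). Therefore n_∞(g_j)
= r_{j+1} - r_j = -n_0(g_{j+1}), and both lowest coefficients equal w(0,0). The sum of the n_0
telescopes around the cycle.

The transfer between O and R rests on approximating solutions of linear equations
(`IsFormalCompletion.exists_approx`), which needs only Artin–Rees and density. For m = 1 the two
branches belong to the same component, and the argument does not change: the same restriction is
expanded at ∞ and at 0. -/

/-! ### Descent along formal completions of Noetherian local rings -/

/-- The ring homomorphism `φ` between local rings identifies the completions of its source and of
its target. -/
structure IsFormalCompletion {O R : Type*} [CommRing O] [IsLocalRing O] [CommRing R]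
    [IsLocalRing R] (φ : O →+* R) : Prop where
  comap_pow : ∀ n : ℕ,
    (IsLocalRing.maximalIdeal R ^ n).comap φ = IsLocalRing.maximalIdeal O ^ n
  dense : ∀ (n : ℕ) (f : R), ∃ a, f - φ a ∈ IsLocalRing.maximalIdeal R ^ n

/-- Krull's intersection theorem. -/
theorem IsLocalRing.exists_notMem_maximalIdeal_pow {R : Type*} [CommRing R] [IsLocalRing R]
    [IsNoetherianRing R] {x : R} (hx : x ≠ 0) : ∃ n, x ∉ maximalIdeal R ^ n := by
  by_contra! h
  refine hx ?_
  rw [← Ideal.mem_bot, ← Ideal.iInf_pow_eq_bot_of_isLocalRing (maximalIdeal R)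
    (IsLocalRing.maximalIdeal.isMaximal R).ne_top]
  simpa using h

namespace IsFormalCompletion

variable {O R : Type*} [CommRing O] [IsLocalRing O] [IsNoetherianRing O]
  [CommRing R] [IsLocalRing R] {φ : O →+* R}

omit [IsNoetherianRing O] in
theorem mem_pow (h : IsFormalCompletion φ) {n : ℕ} {a : O} :
    φ a ∈ IsLocalRing.maximalIdeal R ^ n ↔ a ∈ IsLocalRing.maximalIdeal O ^ n := by
  rw [← h.comap_pow n, Ideal.mem_comap]

theorem injective (h : IsFormalCompletion φ) : Function.Injective φ := by
  rw [injective_iff_map_eq_zero]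
  intro a ha
  by_contra hne
  obtain ⟨n, hn⟩ := IsLocalRing.exists_notMem_maximalIdeal_pow hne
  exact hn (h.mem_pow.mp (ha ▸ zero_mem _))

omit [IsNoetherianRing O] in
theorem isUnit_map (h : IsFormalCompletion φ) {a : O} : IsUnit (φ a) ↔ IsUnit a := by
  have := h.mem_pow (n := 1) (a := a)
  simp only [pow_one, IsLocalRing.mem_maximalIdeal, mem_nonunits_iff] at this
  exact not_iff_not.mp this

/-- Solutions in the completion of a linear equation `a x = b y` are approximated by solutions
in the ring. -/
theorem exists_approx (h : IsFormalCompletion φ) {x y : O} {α β : R} (e : α * φ x = β * φ y)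
    (n : ℕ) : ∃ a b : O, α - φ a ∈ IsLocalRing.maximalIdeal R ^ n ∧
      β - φ b ∈ IsLocalRing.maximalIdeal R ^ n ∧ a * x = b * y := by
  -- Artin–Rees: 𝔪^(n+k) ∩ (x, y) ⊆ 𝔪^n (x, y). Approximating to precision n + k therefore leaves an
  -- error with coefficients in 𝔪^n.
  obtain ⟨k, hk⟩ := Ideal.exists_pow_inf_eq_pow_smul (IsLocalRing.maximalIdeal O)
    (Ideal.span {x, y} : Ideal O)
  obtain ⟨a, ha⟩ := h.dense (n + k) α
  obtain ⟨b, hb⟩ := h.dense (n + k) β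
  have hc : a * x - b * y ∈ IsLocalRing.maximalIdeal O ^ (n + k) := by
    rw [← h.mem_pow]
    have : φ (a * x - b * y) = (β - φ b) * φ y - (α - φ a) * φ x := by
      simp only [map_sub, map_mul]
      linear_combination e
    rw [this]
    exact sub_mem (Ideal.mul_mem_right _ _ hb) (Ideal.mul_mem_right _ _ ha)
  have hs : a * x - b * y ∈ (Ideal.span {x, y} : Ideal O) :=
    sub_mem (Ideal.mul_mem_left _ _ (Ideal.subset_span (by simp)))
      (Ideal.mul_mem_left _ _ (Ideal.subset_span (by simp)))
  have hm : a * x - b * y ∈ IsLocalRing.maximalIdeal O ^ n * Ideal.span {x, y} := by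
    have := (hk (n + k) (by omega)).le
      (show a * x - b * y ∈ _ from ⟨by simpa using hc, hs⟩)
    rw [Nat.add_sub_cancel] at this
    exact Ideal.mul_mono_right inf_le_right this
  rw [Ideal.span_insert, Ideal.mul_sup] at hm
  obtain ⟨p, hp, q, hq, hpq⟩ := Submodule.mem_sup.mp hm
  obtain ⟨p', hp', rfl⟩ := Ideal.mem_mul_span_singleton.mp hp
  obtain ⟨q', hq', rfl⟩ := Ideal.mem_mul_span_singleton.mp hq
  -- The error a x - b y equals p' x + q' y with p', q' in 𝔪^n, so it can be absorbed into the
  -- coefficients.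
  refine ⟨a - p', b + q', ?_, ?_, ?_⟩
  · have : α - φ (a - p') = (α - φ a) + φ p' := by rw [map_sub]; ring
    rw [this]
    exact add_mem (Ideal.pow_le_pow_right (by omega) ha) (h.mem_pow.mpr hp')
  · have : β - φ (b + q') = (β - φ b) - φ q' := by rw [map_add]; ring
    rw [this]
    exact sub_mem (Ideal.pow_le_pow_right (by omega) hb) (h.mem_pow.mpr hq')
  · linear_combination -hpq

/-- Approximate φ x · α = φ y · 1 to first order: the coefficient b of y is congruent to 1 modulo
the maximal ideal, hence a unit. This replaces faithful flatness of the completion. -/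
theorem dvd_of_map_dvd (h : IsFormalCompletion φ) {x y : O} (hd : φ x ∣ φ y) : x ∣ y := by
  obtain ⟨α, hα⟩ := hd
  obtain ⟨a, b, -, hb, e⟩ := h.exists_approx (x := x) (y := y) (α := α) (β := 1)
    (by rw [hα]; ring) 1
  have hu : IsUnit b := by
    rw [← h.isUnit_map]
    by_contra hn
    rw [pow_one] at hb
    have := add_mem hb ((IsLocalRing.mem_maximalIdeal _).mpr hn)
    simp [← Ideal.eq_top_iff_one, (IsLocalRing.maximalIdeal.isMaximal R).ne_top] at this
  rw [← hu.dvd_mul_left]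
  exact ⟨a, by linear_combination -e⟩

variable [IsNoetherianRing R] [IsDomain R] [UniqueFactorizationMonoid R]

/-- The reduced numerator of a fraction over the completion whose value lies in the field of
fractions of the ring is associated to an element of the ring. -/
theorem exists_associated_of_isRelPrime (h : IsFormalCompletion φ) {x y : O} {d α β : R}
    (hx : φ x = d * α) (hy : φ y = d * β) (hαβ : IsRelPrime α β) (hx0 : x ≠ 0) :
    ∃ a : O, Associated α (φ a) ∧ a ∣ x := by
  have hφ : φ x ≠ 0 := (map_ne_zero_iff φ h.injective).mpr hx0
  have hd : d ≠ 0 := fun h0 => hφ (by rw [hx, h0, zero_mul])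
  have hα : α ≠ 0 := fun h0 => hφ (by rw [hx, h0, mul_zero])
  -- The precision n is chosen with α ∉ 𝔪^n. Coprimality gives φ a = α c, and if c were not a unit,
  -- then 1 - c would be, so α - φ a = α (1 - c) ∈ 𝔪^n would force α ∈ 𝔪^n.
  obtain ⟨n, hn⟩ := IsLocalRing.exists_notMem_maximalIdeal_pow hα
  obtain ⟨b, a, -, ha, e⟩ := h.exists_approx (x := x) (y := y) (α := β) (β := α)
    (by rw [hx, hy]; ring) n
  have e' : φ b * α = φ a * β := by
    have := congrArg φ e
    rw [map_mul, map_mul, hx, hy] at this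
    exact mul_left_cancel₀ hd (by linear_combination this)
  obtain ⟨c, hc⟩ : α ∣ φ a := hαβ.dvd_of_dvd_mul_right ⟨φ b, by rw [← e']; ring⟩
  have hu : IsUnit c := by
    by_contra hcu
    refine hn ?_
    have h1 : IsUnit (1 - c) := (IsLocalRing.isUnit_or_isUnit_one_sub_self c).resolve_left hcu
    rw [hc, show α - α * c = α * (1 - c) by ring] at ha
    exact (Ideal.mul_unit_mem_iff_mem _ h1).mp ha
  have hass : Associated α (φ a) := ⟨hu.unit, hc.symm⟩
  exact ⟨a, hass, h.dvd_of_map_dvd (hass.symm.dvd.trans ⟨d, by rw [hx]; ring⟩)⟩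

/-- A Noetherian local domain whose completion is factorial is factorial. -/
theorem uniqueFactorizationMonoid (h : IsFormalCompletion φ) [IsDomain O] :
    UniqueFactorizationMonoid O where
  toIsWellFounded := (inferInstance : WfDvdMonoid O)
  irreducible_iff_prime := by
    refine fun {q} => ⟨fun hq => ⟨hq.ne_zero, hq.not_isUnit, fun x y hxy => ?_⟩, Prime.irreducible⟩
    -- Here d is a gcd of φ q and φ x, and the cofactor α of φ q descends to a divisor a of q. As q
    -- is irreducible, either a is a unit, and q divides x, or a is associated to q, and then α,
    -- being prime to β, divides φ y.
    obtain ⟨α, β, d, hαβ, hα, hβ⟩ := UniqueFactorizationMonoid.exists_reduced_factors (φ q)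
      ((map_ne_zero_iff φ h.injective).mpr hq.ne_zero) (φ x)
    obtain ⟨a, ha, c, rfl⟩ :=
      h.exists_associated_of_isRelPrime hα.symm hβ.symm hαβ hq.ne_zero
    have hd : d ≠ 0 := by
      rintro rfl
      rw [zero_mul, eq_comm, map_eq_zero_iff φ h.injective] at hα
      exact hq.ne_zero hα
    rcases hq.isUnit_or_isUnit rfl with hu | hu
    · left
      refine h.dvd_of_map_dvd ?_
      rw [← hα, ← hβ, ((ha.isUnit_iff).mpr (hu.map φ)).mul_right_dvd]
      exact dvd_mul_right _ _
    · right
      refine h.dvd_of_map_dvd ?_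
      rw [map_mul, (hu.map φ).mul_right_dvd, ← ha.dvd_iff_dvd_left]
      obtain ⟨k, hk⟩ := map_dvd φ hxy
      rw [map_mul, ← hα, ← hβ] at hk
      exact hαβ.dvd_of_dvd_mul_left ⟨k, mul_left_cancel₀ hd (by linear_combination hk)⟩

end IsFormalCompletion

/-! ### Divisors of powers in factorial rings -/

theorem UniqueFactorizationMonoid.exists_dvd_pow_of_prime {O : Type*} [CommRing O] [IsDomain O]
    [UniqueFactorizationMonoid O] {a t : O} (ha : a ≠ 0) (h : ∀ q, Prime q → q ∣ a → q ∣ t) :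
    ∃ n : ℕ, a ∣ t ^ n := by
  induction a using UniqueFactorizationMonoid.induction_on_prime with
  | h₁ => exact absurd rfl ha
  | h₂ x hx => exact ⟨0, hx.dvd⟩
  | h₃ a p ha0 hp ih =>
    obtain ⟨n, hn⟩ := ih ha0 fun q hq hqa => h q hq (hqa.mul_left p)
    exact ⟨n + 1, by rw [pow_succ']; exact mul_dvd_mul (h p hp (dvd_mul_right _ _)) hn⟩

theorem exists_eq_unit_mul_pow_mul_pow_of_dvd {R : Type*} [CommRing R] [IsDomain R]
    [UniqueFactorizationMonoid R] {U V a : R} (hU : Prime U) (hV : Prime V) {n : ℕ}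
    (h : a ∣ (U * V) ^ n) : ∃ (w : Rˣ) (α β : ℕ), a = w * U ^ α * V ^ β := by
  rw [mul_pow] at h
  obtain ⟨x, y, hx, hy, rfl⟩ := exists_dvd_and_dvd_of_dvd_mul h
  obtain ⟨α, -, u, hu⟩ := (dvd_prime_pow hU n).mp hx
  obtain ⟨β, -, v, hv⟩ := (dvd_prime_pow hV n).mp hy
  refine ⟨u⁻¹ * v⁻¹, α, β, ?_⟩
  rw [← hu, ← hv, Units.val_mul]
  linear_combination (-x * y) * u.mul_inv + (-x * y * u * (↑u⁻¹ : R)) * v.mul_inv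

/-! ### Orders and leading terms along a formal branch -/

/-- A branch `U = 0` of the curve `t = U V` in the completion `R` of a local ring `O`: the local
ring `D` of the spectrum of `O` at the generic point of the branch, with its residue map `κ`,
expressed through the restriction `ρ` of formal functions to the branch. -/
structure IsFormalBranch {O R D L : Type*} [CommRing O] [IsLocalRing O] [CommRing R]
    [IsLocalRing R] [CommRing D] [IsLocalRing D] [Field L] (φ : O →+* R) (t : O) (U V : R)
    (ρ : R →+* L) (σ : O →+* D) (κ : D →+* L) : Prop where
  completion : IsFormalCompletion φ
  map_eq : φ t = U * V
  eq_zero_iff : ∀ f, ρ f = 0 ↔ U ∣ f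
  transversal : V ∉ Ideal.span {U} ⊔ IsLocalRing.maximalIdeal R ^ 2
  injective : Function.Injective σ
  exists_fraction : ∀ s, ∃ y z, IsUnit (σ y) ∧ s * σ y = σ z
  isUnit_iff : ∀ s, IsUnit s ↔ κ s ≠ 0
  compatible : ∀ y, κ (σ y) = ρ (φ y)

namespace IsFormalBranch

variable {O R D L : Type*} [CommRing O] [IsLocalRing O] [CommRing R]
    [IsLocalRing R] [CommRing D] [IsLocalRing D] [Field L] {φ : O →+* R} {t : O} {U V : R}
    {ρ : R →+* L} {σ : O →+* D} {κ : D →+* L}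

theorem isUnit_map_iff (h : IsFormalBranch φ t U V ρ σ κ) (y : O) :
    IsUnit (σ y) ↔ ¬ U ∣ φ y := by
  rw [h.isUnit_iff, h.compatible, ne_eq, h.eq_zero_iff]

/-- If z vanishes on the branch, then φ z = U c and V · φ z = c · φ t. Approximating modulo 𝔪² gives
v z = c' t in O with v ≡ V. By transversality v does not vanish on the branch, so it becomes a unit
in D and t divides z there. -/
theorem maximalIdeal_eq [IsNoetherianRing O] (h : IsFormalBranch φ t U V ρ σ κ) :
    IsLocalRing.maximalIdeal D = Ideal.span {σ t} := by
  apply le_antisymm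
  · intro s hs
    obtain ⟨y, z, hy, e⟩ := h.exists_fraction s
    have hz : ¬ IsUnit (σ z) := fun hz => hs (isUnit_of_mul_isUnit_left (e ▸ hz))
    rw [h.isUnit_map_iff, not_not] at hz
    obtain ⟨c, hc⟩ := hz
    obtain ⟨v, c', hv, -, hvc⟩ := h.completion.exists_approx (x := z) (y := t) (α := V) (β := c)
      (by rw [hc, h.map_eq]; ring) 2
    have hu : IsUnit (σ v) := by
      rw [h.isUnit_map_iff]
      intro hd
      refine h.transversal ?_
      rw [← sub_add_cancel V (φ v), add_comm]
      exact Submodule.add_mem_sup (Ideal.mem_span_singleton.mpr hd) hv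
    rw [Ideal.mem_span_singleton, ← hy.dvd_mul_right, e, ← hu.dvd_mul_left, ← map_mul, hvc]
    exact map_dvd σ (dvd_mul_left _ _)
  · rw [Ideal.span_singleton_le_iff_mem, IsLocalRing.mem_maximalIdeal, mem_nonunits_iff,
      h.isUnit_map_iff, not_not, h.map_eq]
    exact dvd_mul_right _ _

/-- The order and the leading term along the branch of a function whose divisor is supported on
`t = 0`. -/
theorem order_eq_and_residue_eq [IsDomain R] (h : IsFormalBranch φ t U V ρ σ κ) (hU : Prime U)
    {a : O} {w : R} (hw : IsUnit w) {α β n : ℕ} (ha : φ a = w * U ^ α * V ^ β) {s : D} (hs : IsUnit s)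
    (e : σ a = s * σ t ^ n) : n = α ∧ κ s * ρ V ^ n = ρ w * ρ V ^ β := by
  have hUV : ¬ U ∣ V := fun hd =>
    h.transversal (Ideal.mem_sup_left (Ideal.mem_span_singleton.mpr hd))
  obtain ⟨y, z, hy, hz⟩ := h.exists_fraction s
  have hzu : IsUnit (σ z) := hz ▸ hs.mul hy
  -- With s = z/y the relation descends to O, and can then be mapped to R.
  have e1 : y * a = z * t ^ n := h.injective (by
    rw [map_mul, map_mul, map_pow, e, ← hz]; ring)
  have e2 := congrArg φ e1
  rw [map_mul, map_mul, map_pow, ha, h.map_eq] at e2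
  have hy' := (h.isUnit_map_iff y).mp hy
  have hz' := (h.isUnit_map_iff z).mp hzu
  have hUn : ∀ k x, ¬ U ∣ x → ¬ U ∣ x * V ^ k := fun k x hx hd =>
    (hU.dvd_or_dvd hd).elim hx fun hd => hUV (hU.dvd_of_dvd_pow hd)
  have hyw : ¬ U ∣ φ y * w := by rwa [hw.dvd_mul_right]
  have hn : n = α := by
    -- Both cofactors are prime to U, so the exponents of U agree.
    have e3 : U ^ α * (φ y * w * V ^ β) = U ^ n * (φ z * V ^ n) := by linear_combination e2
    rcases lt_trichotomy n α with hlt | heq | hlt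
    · exfalso
      obtain ⟨k, rfl⟩ := Nat.exists_eq_add_of_lt hlt
      refine hUn n _ hz' ⟨U ^ k * (φ y * w * V ^ β), ?_⟩
      refine mul_left_cancel₀ (pow_ne_zero n hU.ne_zero) ?_
      linear_combination -e3
    · exact heq
    · exfalso
      obtain ⟨k, rfl⟩ := Nat.exists_eq_add_of_lt hlt
      refine hUn β _ hyw ⟨U ^ k * (φ z * V ^ (α + k + 1)), ?_⟩
      refine mul_left_cancel₀ (pow_ne_zero α hU.ne_zero) ?_
      linear_combination e3
  refine ⟨hn, ?_⟩
  subst hn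
  have e3 : φ y * w * V ^ β = φ z * V ^ n :=
    mul_left_cancel₀ (pow_ne_zero n hU.ne_zero) (by linear_combination e2)
  have e4 := congrArg ρ e3
  have e5 := congrArg κ hz
  simp only [map_mul, map_pow, h.compatible] at e4 e5
  have hy0 : ρ (φ y) ≠ 0 := by rwa [ne_eq, h.eq_zero_iff]
  refine mul_left_cancel₀ hy0 ?_
  linear_combination ρ V ^ n * e5 - e4

end IsFormalBranch

noncomputable section

/-! ### The two branches of UV = 0 in k⟦U⟧⟦V⟧, and Laurent series -/

theorem prime_of_map_eq_zero_iff {R L : Type*} [CommRing R] [Field L] {ρ : R →+* L} {U : R}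
    (hU : U ≠ 0) (h : ∀ f, ρ f = 0 ↔ U ∣ f) : Prime U := by
  refine ⟨hU, fun hu => ?_, fun a b hab => ?_⟩
  · exact one_ne_zero ((map_one ρ).symm.trans ((h 1).mpr hu.dvd))
  · rw [← h, map_mul, mul_eq_zero] at hab
    simpa only [h] using hab

/-- The local homomorphism r kills U and sends 𝔪_R² into 𝔪_A². It is applied to the restriction to
the branch U = 0, where V restricts to a uniformizer. -/
theorem notMem_span_sup_maximalIdeal_sq {R A : Type*} [CommRing R] [IsLocalRing R] [CommRing A]
    [IsLocalRing A] (r : R →+* A) [IsLocalHom r] {U V : R} (hU : r U = 0)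
    (hV : r V ∉ IsLocalRing.maximalIdeal A ^ 2) :
    V ∉ Ideal.span {U} ⊔ IsLocalRing.maximalIdeal R ^ 2 := by
  intro h
  have h2 := Ideal.mem_map_of_mem r h
  rw [Ideal.map_sup, Ideal.map_span, Set.image_singleton, hU, Ideal.span_singleton_eq_bot.mpr rfl,
    bot_sup_eq, Ideal.map_pow] at h2
  exact hV (Ideal.pow_right_mono (((IsLocalRing.local_hom_TFAE r).out 0 2).mp ‹_›) 2 h2)

namespace PowerSeries

variable {k : Type*} [Field k]

theorem X_notMem_maximalIdeal_sq : (X : k⟦X⟧) ∉ IsLocalRing.maximalIdeal k⟦X⟧ ^ 2 := by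
  rw [maximalIdeal_eq_span_X, Ideal.span_singleton_pow, Ideal.mem_span_singleton, X_pow_dvd_iff]
  intro h
  simpa using h 1 (by norm_num)

instance isLocalHom_map_constantCoeff :
    IsLocalHom (map (constantCoeff (R := k)) : k⟦X⟧⟦X⟧ →+* k⟦X⟧) := by
  refine ⟨fun f hf => ?_⟩
  rw [isUnit_iff_constantCoeff] at hf ⊢
  rw [isUnit_iff_constantCoeff]
  rwa [← coeff_zero_eq_constantCoeff_apply (map constantCoeff f), coeff_map,
    coeff_zero_eq_constantCoeff_apply] at hf

instance isLocalHom_constantCoeff {R : Type*} [CommRing R] :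
    IsLocalHom (constantCoeff : R⟦X⟧ →+* R) :=
  ⟨fun _ hf => isUnit_iff_constantCoeff.mpr hf⟩

theorem map_constantCoeff_eq_zero_iff (f : k⟦X⟧⟦X⟧) :
    map (constantCoeff (R := k)) f = 0 ↔ C (X : k⟦X⟧) ∣ f := by
  constructor
  · intro h
    have h1 : ∀ n, (X : k⟦X⟧) ∣ coeff n f := fun n => by
      rw [X_dvd_iff, ← coeff_map, h, map_zero]
    choose g hg using h1
    refine ⟨mk g, ?_⟩
    ext1 n
    rw [coeff_C_mul, coeff_mk, hg]
  · rintro ⟨g, rfl⟩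
    simp

/-- The restriction of formal functions of `(U, V)` to the branch `U = 0`, as a Laurent series in
the coordinate `V`. -/
def branchLeft : k⟦X⟧⟦X⟧ →+* k⸨X⸩ :=
  (HahnSeries.ofPowerSeries ℤ k).comp (map (constantCoeff (R := k)))

/-- The restriction of formal functions of `(U, V)` to the branch `V = 0`, as a Laurent series in
the coordinate `U`. -/
def branchRight : k⟦X⟧⟦X⟧ →+* k⸨X⸩ :=
  (HahnSeries.ofPowerSeries ℤ k).comp (constantCoeff (R := k⟦X⟧))

theorem branchLeft_eq_zero_iff (f : k⟦X⟧⟦X⟧) : branchLeft f = 0 ↔ C (X : k⟦X⟧) ∣ f := by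
  rw [branchLeft, RingHom.comp_apply, map_eq_zero_iff _ HahnSeries.ofPowerSeries_injective,
    map_constantCoeff_eq_zero_iff]

theorem branchRight_eq_zero_iff (f : k⟦X⟧⟦X⟧) : branchRight f = 0 ↔ X ∣ f := by
  rw [branchRight, RingHom.comp_apply, map_eq_zero_iff _ HahnSeries.ofPowerSeries_injective,
    X_dvd_iff]

theorem branchLeft_X : branchLeft (X : k⟦X⟧⟦X⟧) = HahnSeries.single 1 1 := by
  simp [branchLeft]

theorem branchRight_C_X : branchRight (C (X : k⟦X⟧)) = HahnSeries.single 1 1 := by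
  simp [branchRight]

theorem prime_C_X : Prime (C (X : k⟦X⟧)) :=
  prime_of_map_eq_zero_iff ((map_ne_zero_iff _ C_injective).mpr X_ne_zero) branchLeft_eq_zero_iff

theorem X_notMem_span_C_X_sup : (X : k⟦X⟧⟦X⟧) ∉
    Ideal.span {C (X : k⟦X⟧)} ⊔ IsLocalRing.maximalIdeal k⟦X⟧⟦X⟧ ^ 2 :=
  notMem_span_sup_maximalIdeal_sq (map (constantCoeff (R := k))) (by simp)
    (by simpa using X_notMem_maximalIdeal_sq)

theorem C_X_notMem_span_X_sup : C (X : k⟦X⟧) ∉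
    Ideal.span {(X : k⟦X⟧⟦X⟧)} ⊔ IsLocalRing.maximalIdeal k⟦X⟧⟦X⟧ ^ 2 :=
  notMem_span_sup_maximalIdeal_sq (constantCoeff (R := k⟦X⟧)) (by simp)
    (by simpa using X_notMem_maximalIdeal_sq)

end PowerSeries

/-- The order and the leading coefficient of `x`, where `x u ^ n = f u ^ β` for a power series `f`
with nonzero constant coefficient. -/
theorem LaurentSeries.order_eq_and_leadingCoeff_eq {k : Type*} [Field k] {x : k⸨X⸩} {f : k⟦X⟧}
    (hf : PowerSeries.constantCoeff f ≠ 0) {n β : ℕ}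
    (h : x * (HahnSeries.single 1 1 : k⸨X⸩) ^ n =
      HahnSeries.ofPowerSeries ℤ k f * (HahnSeries.single 1 1 : k⸨X⸩) ^ β) :
    x.order = β - n ∧ x.leadingCoeff = PowerSeries.constantCoeff f := by
  have hs : (HahnSeries.single 1 1 : k⸨X⸩) ≠ 0 := by simp
  have hc : (HahnSeries.ofPowerSeries ℤ k f).coeff 0 = PowerSeries.constantCoeff f := by
    have := HahnSeries.ofPowerSeries_apply_coeff (Γ := ℤ) f 0
    simpa using this
  have hf0 : HahnSeries.ofPowerSeries ℤ k f ≠ 0 := by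
    intro h0
    rw [h0] at hc
    exact hf hc.symm
  have ho : (HahnSeries.ofPowerSeries ℤ k f).order = 0 := by
    apply le_antisymm
    · exact HahnSeries.order_le_of_coeff_ne_zero (by rwa [hc])
    · rw [HahnSeries.le_order_iff_forall hf0]
      intro j hj
      rw [PowerSeries.coeff_coe, if_pos hj]
  have hl : (HahnSeries.ofPowerSeries ℤ k f).leadingCoeff = PowerSeries.constantCoeff f := by
    rw [HahnSeries.leadingCoeff_eq, ho, hc]
  have hx : x ≠ 0 := by
    rintro rfl
    rw [zero_mul] at h
    exact mul_ne_zero hf0 (pow_ne_zero _ hs) h.symm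
  constructor
  · have := congrArg HahnSeries.order h
    rw [HahnSeries.order_mul hx (pow_ne_zero _ hs), HahnSeries.order_mul hf0 (pow_ne_zero _ hs),
      HahnSeries.order_pow, HahnSeries.order_pow, HahnSeries.order_single one_ne_zero, ho] at this
    simp only [nsmul_eq_mul, mul_one] at this
    omega
  · have := congrArg HahnSeries.leadingCoeff h
    simpa [HahnSeries.leadingCoeff_mul, HahnSeries.leadingCoeff_of_single, hl] using this
end

noncomputable section

open IsLocalRing

/-! ### Local rings of schemes and morphisms from spectra of local rings -/

theorem IsLocalRing.exists_eq_unit_mul_pow {D : Type*} [CommRing D] [IsLocalRing D]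
    [IsNoetherianRing D] {ϖ : D} (h : maximalIdeal D = Ideal.span {ϖ}) {x : D} (hx : x ≠ 0) :
    ∃ (u : Dˣ) (n : ℕ), x = u * ϖ ^ n := by
  classical
  have hex := exists_notMem_maximalIdeal_pow hx
  obtain ⟨n, hn⟩ : ∃ n, Nat.find hex = n + 1 := by
    refine Nat.exists_eq_succ_of_ne_zero fun h0 => ?_
    have := Nat.find_spec hex
    rw [h0] at this
    simp at this
  have h1 : x ∈ maximalIdeal D ^ n := not_not.mp (Nat.find_min hex (by omega))
  have h2 : x ∉ maximalIdeal D ^ (n + 1) := hn ▸ Nat.find_spec hex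
  rw [h, Ideal.span_singleton_pow, Ideal.mem_span_singleton] at h1 h2
  obtain ⟨u, rfl⟩ := h1
  have hu : IsUnit u := by
    by_contra hu
    have : u ∈ maximalIdeal D := hu
    rw [h, Ideal.mem_span_singleton] at this
    obtain ⟨v, rfl⟩ := this
    exact h2 ⟨v, by ring⟩
  exact ⟨hu.unit, n, mul_comm _ _⟩

theorem IsLocalRing.isDiscreteValuationRing_of_maximalIdeal_eq_span {D : Type*} [CommRing D]
    [IsLocalRing D] [IsNoetherianRing D] [IsDomain D] {ϖ : D} (hϖ : ϖ ≠ 0)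
    (h : maximalIdeal D = Ideal.span {ϖ}) : IsDiscreteValuationRing D := by
  have hf : ¬ IsField D := by
    rw [isField_iff_maximalIdeal_eq, h, Ideal.span_singleton_eq_bot]
    exact hϖ
  have hp : (maximalIdeal D).IsPrincipal := ⟨ϖ, h⟩
  exact ((IsDiscreteValuationRing.TFAE D hf).out 0 4).mpr hp

namespace AlgebraicGeometry.Scheme

universe u

variable {X : Scheme.{u}}

/-- Since ψ need not be local, the closed point of L may land at a proper generization of the closed
point of R. The specialization map accounts for the change of stalk. -/
theorem stalkSpecializes_stalkClosedPointTo_specMap {R L : CommRingCat.{u}} [IsLocalRing R]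
    [IsLocalRing L] (f : Spec R ⟶ X) (ψ : R ⟶ L)
    (h : (Spec.map ψ ≫ f) (closedPoint L) ⤳ f (closedPoint R)) :
    X.presheaf.stalkSpecializes h ≫ stalkClosedPointTo (Spec.map ψ ≫ f) =
      stalkClosedPointTo f ≫ ψ := by
  rw [stalkClosedPointTo_comp]
  have h' : (Spec.map ψ) (closedPoint L) ⤳ closedPoint R := specializes_closedPoint _
  have e := Scheme.Hom.stalkSpecializes_stalkMap f _ _ h'
  have e2 : (Spec R).presheaf.stalkSpecializes h' ≫ stalkClosedPointTo (Spec.map ψ) =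
      (stalkClosedPointIso R).hom ≫ ψ := by
    rw [← Iso.inv_comp_eq, ← cancel_epi (ΓSpecIso R).hom, ← Category.assoc,
      ΓSpecIso_hom_stalkClosedPointIso_inv, ← germ_stalkClosedPointTo_Spec, ← Category.assoc]
    exact congrArg (· ≫ stalkClosedPointTo (Spec.map ψ))
      ((Spec R).presheaf.germ_stalkSpecializes (U := ⊤) trivial h')
  refine (congrArg (· ≫ stalkClosedPointTo (Spec.map ψ)) e).trans ?_
  refine (Category.assoc _ _ _).trans ?_
  refine (congrArg (f.stalkMap (closedPoint R) ≫ ·) e2).trans ?_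
  exact (Category.assoc _ _ _).symm

theorem specMap_comp_closedPoint {R S : CommRingCat.{u}} [IsLocalRing R] [IsLocalRing S]
    (φ : R ⟶ S) [IsLocalHom φ.hom] (f : Spec R ⟶ X) :
    (Spec.map φ ≫ f) (closedPoint S) = f (closedPoint R) :=
  (Scheme.Hom.comp_apply _ _ _).trans (congrArg f Spec_closedPoint)

/-- If a point of `X` with values in a local ring and one with values in a field agree over a
common field extension, then the induced maps from the local rings of `X` agree. -/
theorem exists_specializes_of_specMap_comp_eq {R K L : CommRingCat.{u}} [IsLocalRing R]
    [IsLocalRing K] [IsLocalRing L] (f : Spec R ⟶ X) (g : Spec K ⟶ X) (a : R ⟶ L) (b : K ⟶ L)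
    [IsLocalHom b.hom] (e : Spec.map b ≫ g = Spec.map a ≫ f) :
    ∃ h : g (closedPoint K) ⤳ f (closedPoint R),
      X.presheaf.stalkSpecializes h ≫ stalkClosedPointTo g ≫ b = stalkClosedPointTo f ≫ a := by
  have hg := specMap_comp_closedPoint b g
  have hf : (Spec.map a ≫ f) (closedPoint L) ⤳ f (closedPoint R) :=
    (specializes_closedPoint (R := R) ((Spec.map a) (closedPoint L))).map f.continuous
  have h : g (closedPoint K) ⤳ f (closedPoint R) := by rw [← hg, e]; exact hf
  refine ⟨h, ?_⟩
  rw [← stalkSpecializes_stalkClosedPointTo_specMap g b (specializes_of_eq hg),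
    TopCat.Presheaf.stalkSpecializes_comp_assoc]
  rw [← stalkSpecializes_stalkClosedPointTo_specMap f a hf]
  -- Rewriting along `e` moves the point at which the stalk is taken, so the specialization proof
  -- must vary with it.
  generalize_proofs p1
  revert p1
  rw [e]
  intro _
  rfl

/-- An affine neighbourhood of y also contains x, and the stalk at x is a localization of its ring
of sections. Numerators and denominators thus have germs at y. -/
theorem exists_stalkSpecializes_mul_eq {x y : X} (h : x ⤳ y) (s : X.presheaf.stalk x) :
    ∃ a b : X.presheaf.stalk y, IsUnit (X.presheaf.stalkSpecializes h b) ∧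
      s * X.presheaf.stalkSpecializes h b = X.presheaf.stalkSpecializes h a := by
  obtain ⟨_, ⟨U, hU, rfl⟩, hyU, -⟩ :=
    X.isBasis_affineOpens.exists_subset_of_mem_open (Set.mem_univ y) isOpen_univ
  have hxU : x ∈ U := h.mem_open U.2 hyU
  let _ : Algebra Γ(X, U) (X.presheaf.stalk x) := (X.presheaf.germ U x hxU).hom.toAlgebra
  have := hU.isLocalization_stalk ⟨x, hxU⟩
  obtain ⟨⟨a, b⟩, e⟩ := IsLocalization.surj
    (hU.primeIdealOf ⟨x, hxU⟩).asIdeal.primeCompl (s : X.presheaf.stalk x)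
  have hb := IsLocalization.map_units (M := (hU.primeIdealOf ⟨x, hxU⟩).asIdeal.primeCompl)
    (X.presheaf.stalk x) b
  refine ⟨X.presheaf.germ U y hyU a, X.presheaf.germ U y hyU b, ?_, ?_⟩
  · rw [TopCat.Presheaf.germ_stalkSpecializes_apply]
    exact hb
  · rw [TopCat.Presheaf.germ_stalkSpecializes_apply, TopCat.Presheaf.germ_stalkSpecializes_apply]
    exact e

/-- A prime ideal of the local ring at `y` is the kernel of the passage to the residue field of a
point specializing to `y`. -/
theorem exists_specializes_isUnit_iff (y : X) (P : Ideal (X.presheaf.stalk y)) [hP : P.IsPrime] :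
    ∃ (x : X) (h : x ⤳ y), ∀ a, IsUnit (X.presheaf.stalkSpecializes h a) ↔ a ∉ P := by
  let P' : Spec (X.presheaf.stalk y) := ⟨P, hP⟩
  have h : X.fromSpecStalk y P' ⤳ y := by
    have : X.fromSpecStalk y P' ∈ Set.range (X.fromSpecStalk y) := ⟨_, rfl⟩
    rwa [range_fromSpecStalk] at this
  refine ⟨X.fromSpecStalk y P', h, fun a => ?_⟩
  have e : Spec.map (X.presheaf.stalkSpecializes h) (closedPoint _) = P' := by
    apply (X.fromSpecStalk y).isEmbedding.injective
    refine (Scheme.Hom.comp_apply (Spec.map (X.presheaf.stalkSpecializes h)) (X.fromSpecStalk y)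
      (closedPoint (X.presheaf.stalk _))).symm.trans ?_
    rw [SpecMap_stalkSpecializes_fromSpecStalk]
    exact fromSpecStalk_closedPoint
  have e' : (maximalIdeal _).comap (X.presheaf.stalkSpecializes h).hom = P :=
    congrArg PrimeSpectrum.asIdeal e
  rw [← e', Ideal.mem_comap, mem_maximalIdeal, mem_nonunits_iff, not_not]

/-! ### Stalks inside the function field of an integral scheme -/

section Integral

variable [IsIntegral X]

theorem algebraMap_stalkSpecializes {x y : X} (h : x ⤳ y) (a : X.presheaf.stalk y) :
    algebraMap (X.presheaf.stalk x) X.functionField (X.presheaf.stalkSpecializes h a) =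
      algebraMap (X.presheaf.stalk y) X.functionField a := by
  simp only [RingHom.algebraMap_toAlgebra]
  exact X.presheaf.stalkSpecializes_comp_apply _ _ _

theorem stalkSpecializes_injective {x y : X} (h : x ⤳ y) :
    Function.Injective (X.presheaf.stalkSpecializes h) := by
  refine Function.Injective.of_comp
    (f := algebraMap (X.presheaf.stalk x) X.functionField) ?_
  convert IsFractionRing.injective (X.presheaf.stalk y) X.functionField using 1
  ext a
  exact algebraMap_stalkSpecializes h a

theorem algebraMap_germ {U : X.Opens} {x : X} (hx : x ∈ U) (hg : genericPoint X ∈ U)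
    (s : Γ(X, U)) : algebraMap (X.presheaf.stalk x) X.functionField (X.presheaf.germ U x hx s) =
      X.presheaf.germ U (genericPoint X) hg s := by
  simp only [RingHom.algebraMap_toAlgebra]
  exact X.presheaf.germ_stalkSpecializes_apply _ _ _

/-- Points specializing to x, the generic point among them, correspond to primes of the local ring
at x, and a field has only one. -/
theorem eq_genericPoint_of_isField {x : X} (h : IsField (X.presheaf.stalk x)) :
    x = genericPoint X := by
  have hx : genericPoint X ⤳ x := (genericPoint_spec X).specializes trivial
  have : genericPoint X ∈ Set.range (X.fromSpecStalk x) := by rwa [range_fromSpecStalk]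
  obtain ⟨P, hP⟩ := this
  have : P = closedPoint (X.presheaf.stalk x) := by
    have hPm : maximalIdeal (X.presheaf.stalk x) = ⊥ := isField_iff_maximalIdeal_eq.mp h
    apply PrimeSpectrum.ext
    change P.asIdeal = maximalIdeal _
    rw [hPm, eq_bot_iff, ← hPm]
    exact le_maximalIdeal P.2.ne_top
  rw [← hP, this, fromSpecStalk_closedPoint]

/-! ### Points whose maximal ideal is principal, and orders of vanishing -/

variable [IsLocallyNoetherian X]

/-- Every nonzero element at y is a unit times a power of ϖ, so once ϖ is inverted the stalk at x is
a field. On the base curve this shows that a point where the local coordinate is invertible is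
generic. -/
theorem eq_genericPoint_of_isUnit_stalkSpecializes {x y : X} (h : x ⤳ y) {ϖ : X.presheaf.stalk y}
    (hϖ : maximalIdeal (X.presheaf.stalk y) = Ideal.span {ϖ})
    (hu : IsUnit (X.presheaf.stalkSpecializes h ϖ)) : x = genericPoint X := by
  apply eq_genericPoint_of_isField
  rw [isField_iff_maximalIdeal_eq, eq_bot_iff]
  intro s hs
  obtain ⟨a, b, hb, e⟩ := exists_stalkSpecializes_mul_eq h s
  by_contra hs0
  have ha : a ≠ 0 := by
    rintro rfl
    rw [map_zero] at e
    exact hs0 ((hb.mul_left_eq_zero).mp e)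
  obtain ⟨v, n, rfl⟩ := exists_eq_unit_mul_pow hϖ ha
  refine hs (isUnit_of_mul_isUnit_left (y := X.presheaf.stalkSpecializes h b) ?_)
  rw [e, map_mul, map_pow]
  exact (v.isUnit.map _).mul (hu.pow n)

variable {x : X} {ϖ : X.presheaf.stalk x}

theorem coheight_eq_one_of_maximalIdeal_eq_span (hϖ : ϖ ≠ 0)
    (h : maximalIdeal (X.presheaf.stalk x) = Ideal.span {ϖ}) : Order.coheight x = 1 := by
  have := isDiscreteValuationRing_of_maximalIdeal_eq_span hϖ h
  have h1 := ringKrullDim_stalk_eq_coheight x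
  rw [IsDiscreteValuationRing.ringKrullDim_eq_one] at h1
  exact_mod_cast h1.symm

theorem ord_algebraMap_mul_zpow (hϖ : ϖ ≠ 0)
    (h : maximalIdeal (X.presheaf.stalk x) = Ideal.span {ϖ}) {s : X.presheaf.stalk x}
    (hs : IsUnit s) (n : ℤ) :
    ord (algebraMap _ X.functionField s * algebraMap _ X.functionField ϖ ^ n) x = n := by
  have := isDiscreteValuationRing_of_maximalIdeal_eq_span hϖ h
  have hx := coheight_eq_one_of_maximalIdeal_eq_span hϖ h
  have hinj := IsFractionRing.injective (X.presheaf.stalk x) X.functionField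
  have hirr : Irreducible ϖ := (IsDiscreteValuationRing.irreducible_iff_uniformizer ϖ).mpr h
  rw [ord_eq_iff hx (mul_ne_zero ((map_ne_zero_iff _ hinj).mpr hs.ne_zero)
    (zpow_ne_zero _ ((map_ne_zero_iff _ hinj).mpr hϖ))), map_mul, map_zpow₀]
  have h1 : ordHom x hx (algebraMap _ X.functionField s) = 1 := Ring.ordFrac_of_isUnit hs
  have h2 : ordHom x hx (algebraMap _ X.functionField ϖ) = WithZero.exp 1 :=
    Ring.ordFrac_irreducible hirr
  rw [h1, h2, one_mul, ← WithZero.exp_zsmul]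
  simp [WithZero.exp_eq_coe_ofAdd]

theorem exists_eq_algebraMap_mul_zpow_ord (hϖ : ϖ ≠ 0)
    (h : maximalIdeal (X.presheaf.stalk x) = Ideal.span {ϖ}) {f : X.functionField}
    (hf : f ≠ 0) : ∃ s : X.presheaf.stalk x, IsUnit s ∧
      f = algebraMap _ X.functionField s * algebraMap _ X.functionField ϖ ^ ord f x := by
  have hinj := IsFractionRing.injective (X.presheaf.stalk x) X.functionField
  suffices ∃ (s : X.presheaf.stalk x) (n : ℤ), IsUnit s ∧
      f = algebraMap _ X.functionField s * algebraMap _ X.functionField ϖ ^ n by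
    obtain ⟨s, n, hs, e⟩ := this
    refine ⟨s, hs, ?_⟩
    have := ord_algebraMap_mul_zpow hϖ h hs n
    rw [← e] at this
    rwa [this]
  obtain ⟨a, b, hb, rfl⟩ := IsFractionRing.div_surjective (A := X.presheaf.stalk x) f
  have hb0 : b ≠ 0 := nonZeroDivisors.ne_zero hb
  have ha0 : a ≠ 0 := by
    rintro rfl
    simp at hf
  obtain ⟨u, n, rfl⟩ := exists_eq_unit_mul_pow h ha0
  obtain ⟨v, k, rfl⟩ := exists_eq_unit_mul_pow h hb0
  refine ⟨u * ↑v⁻¹, n - k, u.isUnit.mul v⁻¹.isUnit, ?_⟩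
  have hϖ' := (map_ne_zero_iff _ hinj).mpr hϖ
  have hv := (map_ne_zero_iff _ hinj).mpr v.ne_zero
  rw [div_eq_iff ((map_ne_zero_iff _ hinj).mpr hb0), zpow_sub₀ hϖ', zpow_natCast, zpow_natCast]
  have e : algebraMap _ X.functionField (v : X.presheaf.stalk x) *
      algebraMap _ X.functionField ((v⁻¹ : (X.presheaf.stalk x)ˣ) : X.presheaf.stalk x) = 1 := by
    rw [← map_mul, v.mul_inv, map_one]
  simp only [map_mul, map_pow]
  field_simp
  linear_combination -e

end Integral

end AlgebraicGeometry.Scheme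
end

noncomputable section

namespace EllipticFiber

open IsLocalRing Scheme

/-! ### Branches at a node in terms of the affine coordinates -/

open scoped RatFunc in
/-- The Laurent expansion of a complex rational function at the origin. -/
def laurentExpansion : RatFunc ℂ →+* ℂ⸨X⸩ :=
  algebraMap (RatFunc ℂ) ℂ⸨X⸩

theorem laurentExpansion_algebraMap (p : ℂ[X]) :
    laurentExpansion (algebraMap ℂ[X] (RatFunc ℂ) p) = HahnSeries.ofPowerSeries ℤ ℂ p :=
  (RatFunc.coe_coe p).symm

theorem laurentExpansion_C (a : ℂ) : laurentExpansion (RatFunc.C a) = HahnSeries.C a := by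
  rw [← RatFunc.algebraMap_C, laurentExpansion_algebraMap]
  simp

theorem laurentExpansion_X : laurentExpansion RatFunc.X = HahnSeries.single 1 1 := by
  rw [← RatFunc.algebraMap_X, laurentExpansion_algebraMap]
  simp

theorem laurentExpansion_comp_algebraMap :
    laurentExpansion.comp (algebraMap ℂ[X] (RatFunc ℂ)) =
      (HahnSeries.ofPowerSeries ℤ ℂ).comp (Polynomial.coeToPowerSeries.ringHom (R := ℂ)) := by
  refine RingHom.ext fun p => ?_
  exact laurentExpansion_algebraMap p

theorem swapCoord_algebraMap (p : ℂ[X]) :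
    swapCoord (algebraMap ℂ[X] (RatFunc ℂ) p) =
      Polynomial.eval₂ RatFunc.C (RatFunc.X⁻¹ : RatFunc ℂ) p := by
  simp [swapCoord]

/-- The expansion in powers of `v = 1/T` of a Laurent polynomial in `T`. -/
def expandInfty : LaurentPolynomial ℂ →+* ℂ⸨X⸩ :=
  LaurentPolynomial.eval₂ HahnSeries.C (Units.mk0 (HahnSeries.single (-1 : ℤ) (1 : ℂ)) (by simp))

/-- With `expandInfty_comp_eval₂`, this makes the coordinate ring of the overlap map to ℂ((v))
compatibly with both charts. That carries expansions at u = ∞ across the gluing. -/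
theorem expandInfty_comp_toLaurent :
    expandInfty.comp (Polynomial.toLaurent (R := ℂ)) =
      (laurentExpansion.comp swapCoord).comp (algebraMap ℂ[X] (RatFunc ℂ)) := by
  apply Polynomial.ringHom_ext
  · intro a
    simp only [RingHom.comp_apply, swapCoord_algebraMap]
    simp [expandInfty, laurentExpansion_C]
  · simp only [RingHom.comp_apply, swapCoord_algebraMap]
    simp [expandInfty, laurentExpansion_X]

theorem expandInfty_comp_eval₂ :
    expandInfty.comp
      (Polynomial.eval₂RingHom (LaurentPolynomial.C (R := ℂ)) (LaurentPolynomial.T (-1))) =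
      (HahnSeries.ofPowerSeries ℤ ℂ).comp (Polynomial.coeToPowerSeries.ringHom (R := ℂ)) := by
  apply Polynomial.ringHom_ext
  · intro a
    simp [expandInfty]
  · simp [expandInfty]

/-! ### Functions without horizontal divisor through a point of the fibre -/

namespace EllipticSurface

variable {S : EllipticSurface} {c : Spec (.of ℂ) ⟶ S.C}

namespace LocalCoordinate

variable (t : S.LocalCoordinate c)

/-- The germ at a point of `X` of the pull-back of the local coordinate. -/
def germAt {x : S.X} (hx : x ∈ S.π ⁻¹ᵁ t.U) : S.X.presheaf.stalk x :=
  S.X.presheaf.germ (S.π ⁻¹ᵁ t.U) x hx (S.π.app t.U t.fn)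

theorem algebraMap_germAt {x : S.X} (hx : x ∈ S.π ⁻¹ᵁ t.U) :
    algebraMap (S.X.presheaf.stalk x) S.X.functionField (t.germAt hx) = t.onSurface :=
  algebraMap_germ _ _ _

/-- A point of `X` specializing to a point over `c`, at which the local coordinate is invertible,
lies over the generic point of the base curve. -/
theorem eq_genericPoint_of_isUnit {x p : S.X} (h : x ⤳ p) (hp : S.π p = S.basePoint c)
    (hpU : p ∈ S.π ⁻¹ᵁ t.U) (hu : IsUnit (S.X.presheaf.stalkSpecializes h (t.germAt hpU))) :
    S.π x = genericPoint S.C := by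
  have hs : S.π x ⤳ S.basePoint c := hp ▸ h.map S.π.continuous
  refine eq_genericPoint_of_isUnit_stalkSpecializes hs t.span_eq ?_
  rw [TopCat.Presheaf.germ_stalkSpecializes_apply]
  -- The stalk map of π is local, so it reflects units.
  refine isUnit_of_map_unit (S.π.stalkMap x).hom _ ?_
  rw [germAt, TopCat.Presheaf.germ_stalkSpecializes_apply] at hu
  convert hu using 1
  exact Scheme.Hom.germ_stalkMap_apply S.π t.U x (hs.mem_open t.U.2 t.mem) t.fn

end LocalCoordinate

/-- Near a point of the fibre whose local ring is factorial, a rational function on `X` whose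
horizontal divisor misses the point has numerator and denominator dividing powers of the
local coordinate of the base. -/
theorem exists_algebraMap_eq_and_dvd_pow (t : S.LocalCoordinate c) {p : S.X}
    (hp : S.π p = S.basePoint c) (hpU : p ∈ S.π ⁻¹ᵁ t.U)
    [UniqueFactorizationMonoid (S.X.presheaf.stalk p)] {G : S.X.functionField} (hG : G ≠ 0)
    (hreg : ∀ x : S.X, Order.coheight x = 1 → S.π x = genericPoint S.C → Scheme.ord G x ≠ 0 →
      ¬ x ⤳ p) :
    ∃ (a : S.X.presheaf.stalk p) (N M : ℕ),
      algebraMap _ S.X.functionField a = G * t.onSurface ^ N ∧ a ∣ t.germAt hpU ^ M := by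
  obtain ⟨a, b, hab, rfl⟩ :=
    IsFractionRing.exists_reduced_fraction (A := S.X.presheaf.stalk p) G
  have hinj := IsFractionRing.injective (S.X.presheaf.stalk p) S.X.functionField
  have hb0 : (b : S.X.presheaf.stalk p) ≠ 0 := nonZeroDivisors.ne_zero b.2
  have ha0 : a ≠ 0 := by
    rintro rfl
    simp at hG
  -- A prime q dividing a or b but not t would be the local equation of a prime divisor through p.
  -- As t is invertible at its generic point x, this divisor is horizontal.
  have key : ∀ q : S.X.presheaf.stalk p, Prime q → q ∣ a ∨ q ∣ b → q ∣ t.germAt hpU := by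
    intro q hq hqab
    by_contra hqt
    have : (Ideal.span {q}).IsPrime := (Ideal.span_singleton_prime hq.ne_zero).mpr hq
    obtain ⟨x, h, hx⟩ := exists_specializes_isUnit_iff p (Ideal.span {q})
    simp only [Ideal.mem_span_singleton] at hx
    have hgen := t.eq_genericPoint_of_isUnit h hp hpU ((hx _).mpr hqt)
    set σ := S.X.presheaf.stalkSpecializes h
    have hσq : σ q ≠ 0 := (map_ne_zero_iff σ.hom (stalkSpecializes_injective h)).mpr hq.ne_zero
    have hmax : maximalIdeal (S.X.presheaf.stalk x) = Ideal.span {σ q} := by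
      apply le_antisymm
      · intro s hs
        obtain ⟨y, z, hz, e⟩ := exists_stalkSpecializes_mul_eq h s
        have hy : ¬ IsUnit (σ y) := fun hy => hs (isUnit_of_mul_isUnit_left (e ▸ hy))
        rw [hx, not_not] at hy
        rw [Ideal.mem_span_singleton, ← hz.dvd_mul_right, e]
        exact map_dvd σ.hom hy
      · rw [Ideal.span_singleton_le_iff_mem, mem_maximalIdeal, mem_nonunits_iff, hx, not_not]
    have hcoh := coheight_eq_one_of_maximalIdeal_eq_span hσq hmax
    refine hreg x hcoh hgen ?_ h
    -- If the order of G at x were 0, then a and b would differ by a unit there, so q would divide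
    -- both, against reducedness of the fraction.
    intro h0
    obtain ⟨s, hs, e⟩ := exists_eq_algebraMap_mul_zpow_ord hσq hmax hG
    rw [h0, zpow_zero, mul_one, IsFractionRing.mk'_eq_div,
      div_eq_iff ((map_ne_zero_iff _ hinj).mpr hb0), ← algebraMap_stalkSpecializes h,
      ← algebraMap_stalkSpecializes h, ← map_mul] at e
    have e' : σ a = s * σ b :=
      IsFractionRing.injective (S.X.presheaf.stalk x) S.X.functionField e
    have hiff : q ∣ a ↔ q ∣ b := by
      rw [← not_iff_not, ← hx, ← hx]
      change IsUnit (σ a) ↔ IsUnit (σ b)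
      rw [e', IsUnit.mul_iff, and_iff_right hs]
    exact hq.not_isUnit (hab (by tauto) (by tauto))
  obtain ⟨M, hM⟩ := UniqueFactorizationMonoid.exists_dvd_pow_of_prime ha0
    fun q hq h => key q hq (Or.inl h)
  obtain ⟨N, d, hd⟩ := UniqueFactorizationMonoid.exists_dvd_pow_of_prime hb0
    fun q hq h => key q hq (Or.inr h)
  -- From b d = t^N: a d = (a/b) t^N, and it divides t^M · t^N.
  refine ⟨a * d, N, M + N, ?_, ?_⟩
  · have e := congrArg (algebraMap (S.X.presheaf.stalk p) S.X.functionField) hd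
    rw [map_pow, t.algebraMap_germAt, map_mul] at e
    rw [e, IsFractionRing.mk'_eq_div, map_mul]
    have := (map_ne_zero_iff _ hinj).mpr hb0
    field_simp
  · rw [pow_add]
    exact mul_dvd_mul hM ⟨b, by rw [hd]; ring⟩

/-- The order and the leading term along a branch at a point `p` of a rational function on `X`
whose divisor near `p` is supported on the fibre. -/
theorem order_eq_and_residue_eq {R L : Type*} [CommRing R] [IsLocalRing R] [IsDomain R] [Field L]
    (t : S.LocalCoordinate c) {x p : S.X} (h : x ⤳ p) (hpU : p ∈ S.π ⁻¹ᵁ t.U)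
    {φ : S.X.presheaf.stalk p →+* R} {U V : R} {ρ : R →+* L} {κ : S.X.presheaf.stalk x →+* L}
    (hbr : IsFormalBranch φ (t.germAt hpU) U V ρ (S.X.presheaf.stalkSpecializes h).hom κ)
    (hU : Prime U) (ht : t.germAt hpU ≠ 0) {G : S.X.functionField} (hG : G ≠ 0)
    {a : S.X.presheaf.stalk p} {N α β : ℕ} {w : R} (hw : IsUnit w)
    (ha : algebraMap _ S.X.functionField a = G * t.onSurface ^ N) (hφ : φ a = w * U ^ α * V ^ β)
    {s : S.X.presheaf.stalk x} {r : ℤ} (hs : IsUnit s)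
    (hGs : G = algebraMap _ S.X.functionField s * t.onSurface ^ r) :
    r + N = α ∧ κ s * ρ V ^ α = ρ w * ρ V ^ β := by
  set σ := S.X.presheaf.stalkSpecializes h
  have hmax : maximalIdeal _ = Ideal.span {σ (t.germAt hpU)} := hbr.maximalIdeal_eq
  have hσt : σ (t.germAt hpU) ≠ 0 := (map_ne_zero_iff σ.hom hbr.injective).mpr ht
  have hT : algebraMap _ S.X.functionField (σ (t.germAt hpU)) = t.onSurface := by
    rw [algebraMap_stalkSpecializes, t.algebraMap_germAt]
  have hinj := IsFractionRing.injective (S.X.presheaf.stalk x) S.X.functionField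
  have hT0 : t.onSurface ≠ 0 := by
    rw [← hT]
    exact (map_ne_zero_iff _ hinj).mpr hσt
  have ha0 : a ≠ 0 := by
    rintro rfl
    rw [map_zero] at ha
    exact mul_ne_zero hG (pow_ne_zero N hT0) ha.symm
  obtain ⟨u, n, hun⟩ := exists_eq_unit_mul_pow hmax
    ((map_ne_zero_iff σ.hom hbr.injective).mpr ha0)
  have e1 : algebraMap _ S.X.functionField (u : S.X.presheaf.stalk x) * t.onSurface ^ (n : ℤ) =
      algebraMap _ S.X.functionField s * t.onSurface ^ (r + N : ℤ) := by
    have := algebraMap_stalkSpecializes h a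
    rw [ha, hGs] at this
    rw [zpow_add₀ hT0, zpow_natCast, zpow_natCast, ← mul_assoc, ← this, ← hT, ← map_pow, ← map_mul]
    exact congrArg _ hun.symm
  -- Taking orders in `e1` gives n = r + N, after which the unit parts u and s coincide.
  have h1 := ord_algebraMap_mul_zpow hσt hmax u.isUnit n
  rw [hT, e1, ← hT, ord_algebraMap_mul_zpow hσt hmax hs] at h1
  rw [h1] at e1
  have hus : (u : S.X.presheaf.stalk x) = s := hinj (mul_right_cancel₀ (zpow_ne_zero _ hT0) e1)
  rw [hus] at hun
  obtain ⟨rfl, e2⟩ := hbr.order_eq_and_residue_eq hU hw hφ hs hun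
  exact ⟨h1, e2⟩

/-! ### The two branches at a node of F -/

namespace FiberOfTypeI

variable {m : ℕ} (F : S.FiberOfTypeI c m)

theorem π_node (j : ZMod m) : S.π (F.node j) = S.basePoint c := by
  have e : (affinePoint 0 ≫ F.chartInfty j ≫ pullback.fst S.π c) ≫ S.π = c := by
    rw [Category.assoc, Category.assoc, pullback.condition, ← Category.assoc (F.chartInfty j),
      F.chartInfty_over, ← Category.assoc, affinePoint, ← Spec.map_comp, ← CommRingCat.ofHom_comp]
    have : (Polynomial.evalRingHom (0 : ℂ)).comp Polynomial.C = RingHom.id ℂ := by ext; simp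
    rw [this]
    exact (congrArg (· ≫ c) (Spec.map_id _)).trans (Category.id_comp c)
  exact (Scheme.Hom.comp_apply _ _ _).symm.trans (congrArg (fun f : _ ⟶ S.C => f (closedPoint ℂ)) e)

/-- The expansion of the restriction to `C_j` in powers of `1/u_j`. -/
def residueInfty (j : ZMod m) : S.X.presheaf.stalk (F.component j) →+* ℂ⸨X⸩ :=
  (laurentExpansion.comp swapCoord).comp (stalkClosedPointTo (F.genericChart j)).hom

/-- The expansion of the restriction to `C_j` in powers of `u_j`. -/
def residueZero (j : ZMod m) : S.X.presheaf.stalk (F.component j) →+* ℂ⸨X⸩ :=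
  laurentExpansion.comp (stalkClosedPointTo (F.genericChart j)).hom

theorem isUnit_iff_stalkClosedPointTo_ne_zero (j : ZMod m)
    (s : S.X.presheaf.stalk (F.component j)) :
    IsUnit s ↔ (stalkClosedPointTo (F.genericChart j)).hom s ≠ 0 := by
  rw [← isUnit_iff_ne_zero (G₀ := RatFunc ℂ)]
  exact ⟨fun h => h.map _, (isLocalHom_stalkClosedPointTo' (F.genericChart j)).map_nonunit s⟩

variable {θ : Spec (.of ℂ⟦X⟧⟦X⟧) ⟶ S.X}

theorem closedPoint_eq_node {j : ZMod m}
    (h : Spec.map (CommRingCat.ofHom (PowerSeries.map (PowerSeries.constantCoeff (R := ℂ)))) ≫ θ =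
      Spec.map (CommRingCat.ofHom (Polynomial.coeToPowerSeries.ringHom (R := ℂ))) ≫
        F.chartInfty j ≫ pullback.fst S.π c) :
    θ (closedPoint ℂ⟦X⟧⟦X⟧) = F.node j := by
  have : IsLocalHom (CommRingCat.ofHom
      (PowerSeries.map (PowerSeries.constantCoeff (R := ℂ)))).hom :=
    PowerSeries.isLocalHom_map_constantCoeff
  have : IsLocalHom (CommRingCat.ofHom (PowerSeries.constantCoeff (R := ℂ))).hom :=
    PowerSeries.isLocalHom_constantCoeff
  have e : affinePoint 0 = Spec.map (CommRingCat.ofHom (PowerSeries.constantCoeff (R := ℂ))) ≫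
      Spec.map (CommRingCat.ofHom (Polynomial.coeToPowerSeries.ringHom (R := ℂ))) := by
    rw [← Spec.map_comp, ← CommRingCat.ofHom_comp, affinePoint]
    congr 2
    apply Polynomial.ringHom_ext <;> simp
  rw [node, e, Category.assoc, ← h]
  exact ((specMap_comp_closedPoint _ _).trans (specMap_comp_closedPoint _ _)).symm

/-- Over ℂ((v)) the generic point of C_j, expanded at u_j = ∞, and the branch U = 0 of the formal
chart become the same point of X. Hence the two ways of restricting a germ at the node agree. -/
theorem exists_isFormalBranch_left (t : S.LocalCoordinate c) (hθ : S.IsFormalChart θ)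
    (hU : θ (closedPoint ℂ⟦X⟧⟦X⟧) ∈ S.π ⁻¹ᵁ t.U)
    (ht : (stalkClosedPointTo θ).hom (t.germAt hU) =
      PowerSeries.C (PowerSeries.X : ℂ⟦X⟧) * PowerSeries.X) {j : ZMod m}
    (h : Spec.map (CommRingCat.ofHom (PowerSeries.map (PowerSeries.constantCoeff (R := ℂ)))) ≫ θ =
      Spec.map (CommRingCat.ofHom (Polynomial.coeToPowerSeries.ringHom (R := ℂ))) ≫
        F.chartInfty j ≫ pullback.fst S.π c) :
    ∃ hs : F.component j ⤳ θ (closedPoint ℂ⟦X⟧⟦X⟧),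
      IsFormalBranch (stalkClosedPointTo θ).hom (t.germAt hU)
        (PowerSeries.C (PowerSeries.X : ℂ⟦X⟧)) PowerSeries.X PowerSeries.branchLeft
        (S.X.presheaf.stalkSpecializes hs).hom (F.residueInfty j) := by
  have hglue : Spec.map (CommRingCat.ofHom (Polynomial.toLaurent (R := ℂ))) ≫ F.chart j ≫
      pullback.fst S.π c = punctureInv ≫ F.chartInfty j ≫ pullback.fst S.π c :=
    ((Category.assoc _ _ _).symm.trans
      (congrArg (· ≫ pullback.fst S.π c) (F.glue j))).trans (Category.assoc _ _ _)
  have e : Spec.map (CommRingCat.ofHom (laurentExpansion.comp swapCoord)) ≫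
      F.genericChart j = Spec.map (CommRingCat.ofHom (PowerSeries.branchLeft (k := ℂ))) ≫ θ := by
    rw [PowerSeries.branchLeft, CommRingCat.ofHom_comp _ (HahnSeries.ofPowerSeries ℤ ℂ),
      Spec.map_comp, Category.assoc, h, genericChart, ← Category.assoc, ← Spec.map_comp,
      ← CommRingCat.ofHom_comp, ← expandInfty_comp_toLaurent, CommRingCat.ofHom_comp, Spec.map_comp,
      Category.assoc, hglue, punctureInv, ← Category.assoc, ← Spec.map_comp,
      ← CommRingCat.ofHom_comp, expandInfty_comp_eval₂, CommRingCat.ofHom_comp, Spec.map_comp,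
      Category.assoc]
  have : IsLocalHom (CommRingCat.ofHom (laurentExpansion.comp swapCoord)).hom :=
    inferInstanceAs (IsLocalHom (laurentExpansion.comp swapCoord))
  obtain ⟨hs, e'⟩ := exists_specializes_of_specMap_comp_eq θ (F.genericChart j) _ _ e
  refine ⟨hs, ⟨⟨hθ.comap_pow, hθ.dense⟩, ht, PowerSeries.branchLeft_eq_zero_iff,
    PowerSeries.X_notMem_span_C_X_sup, stalkSpecializes_injective hs, fun s => ?_, fun s => ?_,
    fun y => ?_⟩⟩
  · obtain ⟨z, y, h1, h2⟩ := exists_stalkSpecializes_mul_eq hs s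
    exact ⟨y, z, h1, h2⟩
  · exact (F.isUnit_iff_stalkClosedPointTo_ne_zero j s).trans
      (map_ne_zero (laurentExpansion.comp swapCoord)).symm
  · exact congrArg (fun f => f.hom y) e'

theorem exists_isFormalBranch_right (t : S.LocalCoordinate c) (hθ : S.IsFormalChart θ)
    (hU : θ (closedPoint ℂ⟦X⟧⟦X⟧) ∈ S.π ⁻¹ᵁ t.U)
    (ht : (stalkClosedPointTo θ).hom (t.germAt hU) =
      PowerSeries.C (PowerSeries.X : ℂ⟦X⟧) * PowerSeries.X) {j : ZMod m}
    (h : Spec.map (CommRingCat.ofHom (PowerSeries.constantCoeff (R := ℂ⟦X⟧))) ≫ θ =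
      Spec.map (CommRingCat.ofHom (Polynomial.coeToPowerSeries.ringHom (R := ℂ))) ≫
        F.chart j ≫ pullback.fst S.π c) :
    ∃ hs : F.component j ⤳ θ (closedPoint ℂ⟦X⟧⟦X⟧),
      IsFormalBranch (stalkClosedPointTo θ).hom (t.germAt hU)
        PowerSeries.X (PowerSeries.C (PowerSeries.X : ℂ⟦X⟧)) PowerSeries.branchRight
        (S.X.presheaf.stalkSpecializes hs).hom (F.residueZero j) := by
  have e : Spec.map (CommRingCat.ofHom laurentExpansion) ≫
      F.genericChart j = Spec.map (CommRingCat.ofHom (PowerSeries.branchRight (k := ℂ))) ≫ θ := by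
    rw [PowerSeries.branchRight, CommRingCat.ofHom_comp _ (HahnSeries.ofPowerSeries ℤ ℂ),
      Spec.map_comp, Category.assoc, h, genericChart, ← Category.assoc, ← Spec.map_comp,
      ← CommRingCat.ofHom_comp, laurentExpansion_comp_algebraMap, CommRingCat.ofHom_comp, Spec.map_comp,
      Category.assoc]
  have : IsLocalHom (CommRingCat.ofHom laurentExpansion).hom :=
    inferInstanceAs (IsLocalHom laurentExpansion)
  obtain ⟨hs, e'⟩ := exists_specializes_of_specMap_comp_eq θ (F.genericChart j) _ _ e
  refine ⟨hs, ⟨⟨hθ.comap_pow, hθ.dense⟩, ht.trans (mul_comm _ _),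
    PowerSeries.branchRight_eq_zero_iff, PowerSeries.C_X_notMem_span_X_sup,
    stalkSpecializes_injective hs, fun s => ?_, fun s => ?_, fun y => ?_⟩⟩
  · obtain ⟨z, y, h1, h2⟩ := exists_stalkSpecializes_mul_eq hs s
    exact ⟨y, z, h1, h2⟩
  · exact (F.isUnit_iff_stalkClosedPointTo_ne_zero j s).trans (map_ne_zero laurentExpansion).symm
  · exact congrArg (fun f => f.hom y) e'

variable {F}

/-- One formal chart on C_j, here at the node where u_j = ∞, already shows that t is a uniformizer
at the generic point of C_j. -/
theorem IsStandard.exists_isUnit_eq {t : S.LocalCoordinate c} (hF : F.IsStandard t)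
    {G : S.X.functionField} (hG : G ≠ 0) (j : ZMod m) :
    ∃ s : S.X.presheaf.stalk (F.component j), IsUnit s ∧
      G = algebraMap _ S.X.functionField s * t.onSurface ^ Scheme.ord G (F.component j) := by
  obtain ⟨θ, hθ, ⟨hU, ht⟩, -, h⟩ := hF.extend_coords j
  obtain ⟨hs, hbr⟩ := F.exists_isFormalBranch_left t hθ hU ht h
  have ht0 : t.germAt hU ≠ 0 := fun h0 => by
    have := hbr.map_eq
    rw [h0, map_zero] at this
    exact mul_ne_zero PowerSeries.prime_C_X.ne_zero PowerSeries.X_ne_zero this.symm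
  have := exists_eq_algebraMap_mul_zpow_ord
    ((map_ne_zero_iff _ hbr.injective).mpr ht0) hbr.maximalIdeal_eq hG
  have hT := algebraMap_stalkSpecializes hs (t.germAt hU)
  rw [t.algebraMap_germAt] at hT
  rwa [← hT]

/-- The behaviour at a node of the restrictions of `G / π ^ r` to the two components through it. -/
theorem IsStandard.order_and_leadingCoeff_at_node {t : S.LocalCoordinate c} (hF : F.IsStandard t)
    {G : S.X.functionField} (hG : G ≠ 0) (hreg : F.IsRegularAtNodes G) (j : ZMod m)
    {s : S.X.presheaf.stalk (F.component j)} (hs : IsUnit s) {r : ℤ}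
    (hGs : G = algebraMap _ S.X.functionField s * t.onSurface ^ r)
    {s' : S.X.presheaf.stalk (F.component (j + 1))} (hs' : IsUnit s') {r' : ℤ}
    (hGs' : G = algebraMap _ S.X.functionField s' * t.onSurface ^ r') :
    (F.residueInfty j s).order = r' - r ∧ (F.residueZero (j + 1) s').order = r - r' ∧
      (F.residueInfty j s).leadingCoeff = (F.residueZero (j + 1) s').leadingCoeff := by
  obtain ⟨θ, hθ, ⟨hU, ht⟩, h', h⟩ := hF.extend_coords j
  have hnode := F.closedPoint_eq_node h
  obtain ⟨hsp, hbr⟩ := F.exists_isFormalBranch_left t hθ hU ht h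
  obtain ⟨hsp', hbr'⟩ := F.exists_isFormalBranch_right t hθ hU ht h'
  have hpr : Prime (PowerSeries.X : ℂ⟦X⟧⟦X⟧) := PowerSeries.X_prime
  have ht0 : t.germAt hU ≠ 0 := fun h0 => by
    have := hbr.map_eq
    rw [h0, map_zero] at this
    exact mul_ne_zero PowerSeries.prime_C_X.ne_zero hpr.ne_zero this.symm
  have := hbr.completion.uniqueFactorizationMonoid
  obtain ⟨a, N, M, ha, hd⟩ := exists_algebraMap_eq_and_dvd_pow t
    ((congrArg S.π hnode).trans (F.π_node j)) hU hG
    fun x h1 h2 h3 h4 => hreg x h1 h2 h3 j (hnode ▸ h4)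
  have hd' := map_dvd (stalkClosedPointTo θ).hom hd
  rw [map_pow, hbr.map_eq] at hd'
  obtain ⟨w, α, β, hφ⟩ := exists_eq_unit_mul_pow_mul_pow_of_dvd PowerSeries.prime_C_X hpr hd'
  obtain ⟨hα, eα⟩ := order_eq_and_residue_eq t hsp hU hbr PowerSeries.prime_C_X ht0 hG w.isUnit ha
    hφ hs hGs
  -- The same a and w are used on the other branch, with U, V and α, β interchanged. Sharing the
  -- unit w is what makes the leading coefficients match.
  obtain ⟨hβ, eβ⟩ := order_eq_and_residue_eq t hsp' hU hbr' hpr ht0 hG w.isUnit ha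
    (β := α) (α := β) (hφ.trans (by ring)) hs' hGs'
  rw [PowerSeries.branchLeft_X] at eα
  rw [PowerSeries.branchRight_C_X] at eβ
  have hw := PowerSeries.isUnit_iff_constantCoeff.mp w.isUnit
  have hw0 := (PowerSeries.isUnit_iff_constantCoeff.mp hw).ne_zero
  -- The restrictions w(0,V) and w(U,0) have the same constant term w(0,0).
  have hww : PowerSeries.constantCoeff (PowerSeries.map PowerSeries.constantCoeff
      (w : ℂ⟦X⟧⟦X⟧)) = PowerSeries.constantCoeff (PowerSeries.constantCoeff (w : ℂ⟦X⟧⟦X⟧)) := by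
    rw [← PowerSeries.coeff_zero_eq_constantCoeff_apply (PowerSeries.map _ _),
      PowerSeries.coeff_map, PowerSeries.coeff_zero_eq_constantCoeff_apply]
  obtain ⟨o1, l1⟩ := LaurentSeries.order_eq_and_leadingCoeff_eq (hww ▸ hw0) eα
  obtain ⟨o2, l2⟩ := LaurentSeries.order_eq_and_leadingCoeff_eq hw0 eβ
  exact ⟨by omega, by omega, by rw [l1, l2, hww]⟩

end FiberOfTypeI

end EllipticSurface

end EllipticFiber

end

/-! ### From the nodes to the cycle -/

theorem lemma6p3 (S : EllipticFiber.EllipticSurface)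
    (c : Spec (.of ℂ) ⟶ S.C) (hc : c ≫ S.str = 𝟙 (Spec (.of ℂ)))
    (m : ℕ) [NeZero m] (F : S.FiberOfTypeI c m)
    (t : S.LocalCoordinate c) (hF : F.IsStandard t)
    (G : S.X.functionField) (hG : G ≠ 0) (hreg : F.IsRegularAtNodes G) :
    ∃ g ∈ EllipticFiber.functionGroup m, ∀ j : ZMod m,
      F.RestrictsTo j (G / t.onSurface ^ Scheme.ord G (F.component j)) (g j : RatFunc ℂ) := by
  choose s hs hGs using hF.exists_isUnit_eq hG
  have hnode := fun j => hF.order_and_leadingCoeff_at_node hG hreg j (hs j) (hGs j) (hs (j + 1))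
    (hGs (j + 1))
  have hT : ∀ j, t.onSurface ^ Scheme.ord G (F.component j) ≠ 0 := fun j h0 =>
    hG ((hGs j).trans (by rw [h0, mul_zero]))
  refine ⟨fun j => Units.mk0 ((Scheme.stalkClosedPointTo (F.genericChart j)).hom (s j))
    ((F.isUnit_iff_stalkClosedPointTo_ne_zero j (s j)).mp (hs j)), ⟨fun j => ?_, fun j => ?_, ?_⟩,
    fun j => ⟨s j, ?_, rfl⟩⟩
  · have h1 := (hnode j).1
    have h2 := (hnode j).2.1
    change (F.residueInfty j (s j)).order + (F.residueZero (j + 1) (s (j + 1))).order = 0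
    omega
  · exact (hnode j).2.2
  · rw [← Equiv.sum_comp (Equiv.addRight (1 : ZMod m))]
    change ∑ j, (F.residueZero (j + 1) (s (j + 1))).order = 0
    rw [Finset.sum_congr rfl fun j _ => (hnode j).2.1, Finset.sum_sub_distrib, sub_eq_zero]
    exact (Equiv.sum_comp (Equiv.addRight (1 : ZMod m))
      fun j => Scheme.ord G (F.component j)).symm
  · exact eq_div_of_mul_eq (hT j) (hGs j).symm
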